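/- Let $d\ge 1$, $\beta>0$ and $a>b>0$. **Model.** Let $q_k=(4\pi\beta)^{-d/2}k^{-1-d/2}$ for $k\in\mathbb N$. For $\alpha<0$ and a centred box $\Lambda\subset\mathbb R^d$, let $\mathsf Q$ be the law of independent cycle counts $N_k$, $k\in\mathbb N$, where $N_k$ is Poisson with parameter $|\Lambda|q_k e^{\beta\alpha k}$, and let $\mathsf E$ be its expectation. Put $\lambda_k=N_k/|\Lambda|$, $\bar q^{(\alpha)}=\sum_k q_ke^{\beta\alpha k}$ and, for $m_\Lambda\in\mathbb N$ and $\mu\in\mathbb R$, $$H_\Lambda=|\Lambda|\Big(-(\mu-\alpha)\sum_k k\lambda_k+\frac a2\Big(\sum_k k\lambda_k\Big)^2-\frac b2\sum_{k\ge m_\Lambda}k^2\lambda_k^2\Big).$$ For $\kappa\in[0,\infty]$ the thermodynamic pressure is $$p^{(\kappa)}(\beta,\alpha,\mu)=\lim \frac1{\beta|\Lambda|}\log\Big(e^{|\Lambda|\bar q^{(\alpha)}}\,\mathsf E\big[e^{-\beta H_\Lambda}\big]\Big),$$ where the limit is along any sequence of centred boxes with $|\Lambda|\to\infty$ and any $m_\Lambda\to\infty$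 with $m_\Lambda/|\Lambda|\to\kappa$. **Ideal gas.** Let $p_0(\beta,s)=\frac1\beta\sum_k q_ke^{\beta sk}$ for $s\le 0$, with $'$ denoting $\partial_s$, and $f_0(\beta,x)=\sup_{s\le0}\{sx-p_0(\beta,s)\}$ for $x\ge0$. Let $\varrho_c=(4\pi\beta)^{-d/2}\sum_k k^{-d/2}$ if $d\ge3$ and $\varrho_c=\infty$ if $d\le2$, and let $\mu_c=a\varrho_c$. For $x>0$ let $s_\beta(x)=0$ if $x\ge\varrho_c$, and otherwise let $s_\beta(x)$ be the unique $s<0$ with $p_0'(\beta,s)=x$. **Rate function.** For $\kappa\in[0,\infty]$ let $\mathbb K(\kappa)=\mathbb R_+\times(\{0\}\cup[\kappa,\infty))$ (so $\mathbb K(\infty)=\mathbb R_+\times\{0\}$) and $$G_\mu(x,y)=\mu(x+y)-\frac a2(x+y)^2+\frac b2y^2-f_0(\beta,x).$$ Let $I^{(\kappa)}_\mu=\sup_{\mathbb K(\kappa)}G_\mu-G_\mu$ on $\mathbb K(\kappa)$ and $I^{(\kappa)}_\mu=+\infty$ elsewhere. Call $\bar\mu\in\mathbb R$ a *transition potential*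 for $\kappa$ if $I^{(\kappa)}_\mu$ has exactly one zero $(x,y)$ for every $\mu\ne\bar\mu$, with $y=0$ if $\mu<\bar\mu$ and $y>0$ if $\mu>\bar\mu$. There is at most one such $\bar\mu$. **Parameters.** Let $\mu_t=\inf_{s<0}\{a\,p_0'(\beta,s)-\frac{a-b}{b}s\}$. For $\mu\ge\mu_t$ let $\tilde x_2(\mu)$ be the smallest $x>0$ with $s_\beta(x)=-\frac b{a-b}(\mu-ax)$. For $\kappa\in(0,\infty)$ let $\mu_r=\mu_r(\kappa)=\inf\{s\ge\mu_t:\tilde x_2(s)\le\frac1a(s-\kappa(a-b))\}$. Let $$p_{\rm sub}(\beta,\mu)=\inf_{s<0}\Big\{\frac{(\mu-s)^2}{2a}+p_0(\beta,s)\Big\},\qquad p_{\rm sup}(\beta,\mu)=\sup_{s<0,\ a\,p_0'(\beta,s)\le\mu}\Big\{\frac{(\mu-s)^2}{2a}-\frac{s^2}{2b}+p_0(\beta,s)\Big\}.$$ **Claim.** In each case below the limit defining $p^{(\kappa)}(\beta,\alpha,\mu)$ exists for all $\alpha<0$ and $\mu\in\mathbb R$, and it has the stated value. 1. ($\kappa=0$)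 There is a transition potential $\mu^*$ for $\kappa=0$. It satisfies $\mu_t\le\mu^*\le\mu_c$, and $$p^{(0)}(\beta,\alpha,\mu)=\begin{cases}p_{\rm sub}(\beta,\mu)&\text{for }\mu\le\mu^*,\\ p_{\rm sup}(\beta,\mu)&\text{for }\mu\ge\mu^*.\end{cases}$$ 2. ($\kappa\in(0,\infty)$) There is a transition potential $\mu^*_\kappa$ for $\kappa$. It satisfies $\mu^*_\kappa=\mu^*$ if $\mu_r\le\mu^*$, and $\mu^*<\mu^*_\kappa<\mu_r$ if $\mu_r>\mu^*$. Moreover $$p^{(\kappa)}(\beta,\alpha,\mu)=\begin{cases}p_{\rm sub}(\beta,\mu)&\text{for }\mu\le\mu^*_\kappa,\\ p_{\rm sub}(\beta,\mu-a\kappa)+\mu\kappa-\frac{a-b}2\kappa^2&\text{for }\mu\in[\mu^*_\kappa,\mu_r],\\ p_{\rm sup}(\beta,\mu)&\text{for }\mu\ge\max\{\mu_r,\mu^*\}.\end{cases}$$ 3. ($\kappa=\infty$) $p^{(\infty)}(\beta,\alpha,\mu)=p_{\rm sub}(\beta,\mu)$ for all $\mu\in\mathbb R$. -/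

import Mathlib

open Filter Topology MeasureTheory
open scoped ENNReal

namespace CycleHYL

noncomputable section

/-! ### The ideal Bose gas and the reference process of cycle counts -/

/-- The cycle weights `q_k = (4πβ)^{-d/2} k^{-(1+d/2)}`. -/
def cycleWeight (d : ℕ) (β : ℝ) (k : ℕ+) : ℝ :=
  1 / ((4 * Real.pi * β) ^ ((d : ℝ) / 2) * (k : ℝ) ^ (1 + (d : ℝ) / 2))

/-- The total intensity `∑_k q_k e^{β α k}`, for `α ≤ 0`. -/
def totalWeight (d : ℕ) (β α : ℝ) : ℝ :=
  ∑' k : ℕ+, cycleWeight d β k * Real.exp (β * α * k)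

/-- The pressure `p₀(β, s)` of the ideal Bose gas. The series converges exactly for `s ≤ 0`; the
pressure is `+∞` for `s > 0`, and this definition is only ever used at `s ≤ 0`. -/
def idealPressure (d : ℕ) (β s : ℝ) : ℝ := (1 / β) * totalWeight d β s

/-- The free energy `f₀(β, x) = sup_s {s x - p₀(β, s)}` for `x ≥ 0`. Only `s ≤ 0` contributes to
the supremum, since `p₀(β, s) = +∞` for `s > 0`. -/
def freeEnergy (d : ℕ) (β x : ℝ) : ℝ :=
  sSup ((fun s : ℝ => s * x - idealPressure d β s) '' Set.Iic 0)

/-- A configuration of cycle counts: `N k` is the number of cycles of length `k` in the box. A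
summable family of natural numbers has finite support. The normalised count is
`λ_k = N k / V` in a box of volume `V`. -/
abbrev CycleCounts : Type := ℕ+ →₀ ℕ

/-- The probability of the cycle counts `N` under the reference process in a box of volume `V`:
the `N k` are independent Poisson variables of parameters `V q_k e^{β α k}`. -/
def refProb (d : ℕ) (β α V : ℝ) (N : CycleCounts) : ℝ :=
  Real.exp (-(V * totalWeight d β α)) *
    N.prod fun k n => (V * cycleWeight d β k * Real.exp (β * α * k)) ^ n / (n.factorial : ℝ)

/-- Expectation with respect to the reference process. -/
def refExpectation (d : ℕ) (β α V : ℝ) (f : CycleCounts → ℝ) : ℝ :=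
  ∑' N : CycleCounts, refProb d β α V N * f N

/-- The Hamiltonian of the spatial cycle HYL model in a box of volume `V`,
`V (-(μ-α) ∑ k λ_k + a/2 (∑ k λ_k)² - b/2 ∑_{k ≥ m} k² λ_k²)`. -/
def hamiltonian (α μ a b V : ℝ) (m : ℕ) (N : CycleCounts) : ℝ :=
  V * (-(μ - α) * (N.sum fun k n => (k : ℝ) * ((n : ℝ) / V))
    + a / 2 * (N.sum fun k n => (k : ℝ) * ((n : ℝ) / V)) ^ 2
    - b / 2 * (N.sum fun k n => if m ≤ (k : ℕ) then (k : ℝ) ^ 2 * ((n : ℝ) / V) ^ 2 else 0))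

/-- The partition function in a box of volume `V`. -/
def partitionFunction (d : ℕ) (β α μ a b V : ℝ) (m : ℕ) : ℝ :=
  Real.exp (V * totalWeight d β α) *
    refExpectation d β α V fun N => Real.exp (-(β * hamiltonian α μ a b V m N))

/-- The pressure in a box of volume `V`. -/
def finitePressure (d : ℕ) (β α μ a b V : ℝ) (m : ℕ) : ℝ :=
  1 / (β * V) * Real.log (partitionFunction d β α μ a b V m)

/-- The centred box in `ℝ^d` with side lengths `L i`. -/
def centredBox {d : ℕ} (L : Fin d → ℝ) : Set (EuclideanSpace ℝ (Fin d)) :=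
  {x | ∀ i, |x i| ≤ L i / 2}

/-- `p` is the thermodynamic pressure of the spatial cycle HYL model with parameter `κ`: along
every sequence of centred boxes `Λ` with `|Λ| → ∞` and every `m → ∞` with `m / |Λ| → κ`, the
finite-volume pressures converge to `p`. -/
def HasPressure (d : ℕ) (β α μ a b : ℝ) (κ : ℝ≥0∞) (p : ℝ) : Prop :=
  ∀ (L : ℕ → Fin d → ℝ) (m : ℕ → ℕ),
    (∀ n i, 0 < L n i) →
    Tendsto (fun n => volume (centredBox (L n))) atTop (𝓝 ∞) →
    Tendsto m atTop atTop →
    Tendsto (fun n => (m n : ℝ≥0∞) / volume (centredBox (L n))) atTop (𝓝 κ) →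
    Tendsto (fun n => finitePressure d β α μ a b (volume (centredBox (L n))).toReal (m n))
      atTop (𝓝 p)

/-! ### The rate function and its zeroes -/

/-- The set `ℝ₊ × ({0} ∪ [κ, ∞))`, for `κ ∈ [0, ∞]`. -/
def admissible (κ : ℝ≥0∞) : Set (ℝ × ℝ) :=
  {z | 0 ≤ z.1 ∧ 0 ≤ z.2 ∧ (z.2 = 0 ∨ κ ≤ ENNReal.ofReal z.2)}

/-- `μ (x+y) - a/2 (x+y)² + b/2 y² - f₀(β, x)`. -/
def pressureFunctional (d : ℕ) (β μ a b : ℝ) (z : ℝ × ℝ) : ℝ :=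
  μ * (z.1 + z.2) - a / 2 * (z.1 + z.2) ^ 2 + b / 2 * z.2 ^ 2 - freeEnergy d β z.1

/-- The rate function of the pair empirical particle density. -/
def rateFunction (d : ℕ) (β μ a b : ℝ) (κ : ℝ≥0∞) (z : ℝ × ℝ) : EReal :=
  open Classical in
  if z ∈ admissible κ then
    ((sSup (pressureFunctional d β μ a b '' admissible κ) - pressureFunctional d β μ a b z : ℝ) :
      EReal)
  else ⊤

/-- The zeroes of the rate function. -/
def zeroes (d : ℕ) (β μ a b : ℝ) (κ : ℝ≥0∞) : Set (ℝ × ℝ) :=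
  {z | rateFunction d β μ a b κ z = 0}

/-- `m` is the transition chemical potential: the rate function has exactly one zero for each
`μ ≠ m`, whose second component (the density in infinitely long cycles) is `0` for `μ < m` and
positive for `μ > m`. -/
def IsTransition (d : ℕ) (β a b : ℝ) (κ : ℝ≥0∞) (m : ℝ) : Prop :=
  (∀ μ < m, ∃ x : ℝ, zeroes d β μ a b κ = {(x, 0)}) ∧
  (∀ μ > m, ∃ x y : ℝ, 0 < y ∧ zeroes d β μ a b κ = {(x, y)})

/-! ### Critical parameters -/

/-- The critical density of the ideal Bose gas; it is infinite in dimensions 1 and 2. -/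
def criticalDensity (d : ℕ) (β : ℝ) : EReal :=
  if 3 ≤ d then
    ((1 / (4 * Real.pi * β) ^ ((d : ℝ) / 2) * ∑' k : ℕ+, 1 / (k : ℝ) ^ ((d : ℝ) / 2) : ℝ) : EReal)
  else ⊤

/-- `s_β(x)`: it is `0` for `x ≥ ϱ_c`, and for `0 < x < ϱ_c` it is the unique `s < 0` with
`p₀'(β, s) = x` (the supremum is over a one-point set). -/
def sBeta (d : ℕ) (β x : ℝ) : ℝ :=
  open Classical in
  if criticalDensity d β ≤ (x : EReal) then 0
  else sSup {s : ℝ | s < 0 ∧ deriv (idealPressure d β) s = x}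

/-- `μ_c = a ϱ_c`. -/
def muC (d : ℕ) (β a : ℝ) : EReal := (a : EReal) * criticalDensity d β

/-- `μ_t = inf_{s<0} {a p₀'(β, s) - ((a-b)/b) s}`. -/
def muT (d : ℕ) (β a b : ℝ) : ℝ :=
  sInf ((fun s : ℝ => a * deriv (idealPressure d β) s - (a - b) / b * s) '' Set.Iio 0)

/-- For `μ ≥ μ_t`, the minimal solution `x > 0` of `s_β(x) = -(b/(a-b)) (μ - a x)`. -/
def xTwo (d : ℕ) (β a b μ : ℝ) : ℝ :=
  sInf {x : ℝ | 0 < x ∧ sBeta d β x = -(b / (a - b)) * (μ - a * x)}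

/-- `μ_r = inf {s ≥ μ_t : x₂(s) ≤ (s - κ (a-b)) / a}`. -/
def muR (d : ℕ) (β a b κ : ℝ) : ℝ :=
  sInf {s : ℝ | muT d β a b ≤ s ∧ xTwo d β a b s ≤ 1 / a * (s - κ * (a - b))}

/-! ### Sub- and supercritical pressure -/

/-- `p_sub(β, μ) = inf_{s<0} {(μ-s)²/(2a) + p₀(β, s)}`. -/
def pSub (d : ℕ) (β a μ : ℝ) : ℝ :=
  sInf ((fun s : ℝ => (μ - s) ^ 2 / (2 * a) + idealPressure d β s) '' Set.Iio 0)

/-- `p_sup(β, μ) = sup {(μ-s)²/(2a) - s²/(2b) + p₀(β, s) : s < 0, a p₀'(β, s) ≤ μ}`. The side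
condition says that the density `y = (μ - a x)/(a-b)`, where `x = p₀'(β, s)`, is nonnegative; it
holds for all `s < 0` when `μ ≥ μ_c`. -/
def pSup (d : ℕ) (β a b μ : ℝ) : ℝ :=
  sSup ((fun s : ℝ => (μ - s) ^ 2 / (2 * a) - s ^ 2 / (2 * b) + idealPressure d β s) ''
    {s : ℝ | s < 0 ∧ a * deriv (idealPressure d β) s ≤ μ})

end

end CycleHYL

/-!
The partition function is a sum over cycle counts `N` of Poisson weights times `exp (-β H)`, and `H`
depends on `N` essentially only through the density `x` of short cycles (shorter than `m_Λ`) and the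
density `y` of long ones. Long cycles carry no entropy on the scale `|Λ|`, so `y` costs nothing, and
`∑ k² λ_k²` over the long cycles is largest, namely `y²`, when a single cycle carries all of `y`;
such a cycle has length at least `m_Λ ≈ κ |Λ|`, whence the constraint `y = 0 ∨ κ ≤ y`. The pressure
is therefore the maximum of `G_μ` over `𝕂(κ)`.

For given `y` the short cycles see the chemical potential `μ - a y`. Maximising over `x` gives the
reduced functional `p_sub (μ - a y) + μ y - (a - b) / 2 * y ^ 2`, and everything reduces to
maximising this function of the single variable `y`. Its stationary points `y > 0` are `y = -s / b`
with `s < 0` and `a p₀'(s) - (a - b) / b * s = μ`. The left-hand side is strictly convex in `s`, so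
there are at most two of them, and only the larger `y` can be a maximum. The gain
`reducedFunctional y - reducedFunctional 0` from a long density `y` increases with `μ`, strictly
where it matters; hence there is a single threshold `μ*` above which long cycles appear. For
`0 < κ < ∞` the maximiser above the threshold is either the unconstrained one or `y = κ`, and `μ_r`
is the potential from which the unconstrained maximiser is at least `κ`.
-/

namespace CycleHYL

open Set

/-! ### The ideal gas -/

section IdealGas

variable {d : ℕ} {β : ℝ}

lemma one_le_cycleLength (k : ℕ+) : (1 : ℝ) ≤ k := by exact_mod_cast k.2

lemma cycleLength_pos (k : ℕ+) : (0 : ℝ) < k := by exact_mod_cast k.pos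

lemma cycleWeight_pos (hβ : 0 < β) (k : ℕ+) : 0 < cycleWeight d β k := by
  have := cycleLength_pos k
  have := Real.pi_pos
  unfold cycleWeight
  positivity

lemma mul_cycleWeight (hβ : 0 < β) (k : ℕ+) :
    k * cycleWeight d β k =
      1 / (4 * Real.pi * β) ^ ((d : ℝ) / 2) * (1 / (k : ℝ) ^ ((d : ℝ) / 2)) := by
  have hk := cycleLength_pos k
  have := Real.pi_pos
  have : (0 : ℝ) < (4 * Real.pi * β) ^ ((d : ℝ) / 2) := by positivity
  have : (0 : ℝ) < (k : ℝ) ^ ((d : ℝ) / 2) := by positivity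
  rw [cycleWeight, Real.rpow_add hk, Real.rpow_one]
  field_simp

lemma mul_cycleWeight_le (hβ : 0 < β) (k : ℕ+) :
    k * cycleWeight d β k ≤ 1 / (4 * Real.pi * β) ^ ((d : ℝ) / 2) := by
  have := Real.pi_pos
  have hk : (1 : ℝ) ≤ (k : ℝ) ^ ((d : ℝ) / 2) :=
    Real.one_le_rpow (one_le_cycleLength k) (by positivity)
  rw [mul_cycleWeight hβ]
  exact mul_le_of_le_one_right (by positivity) (div_le_one_of_le₀ hk (by positivity))

lemma summable_one_div_cycleLength_rpow_iff {r : ℝ} :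
    Summable (fun k : ℕ+ => 1 / (k : ℝ) ^ r) ↔ 1 < r :=
  (summable_pnat_iff_summable_nat (f := fun k : ℕ => 1 / (k : ℝ) ^ r)).trans
    Real.summable_one_div_nat_rpow

lemma summable_cycleWeight (hd : 1 ≤ d) (β : ℝ) : Summable (cycleWeight d β) := by
  have hd' : (1 : ℝ) ≤ d := by exact_mod_cast hd
  have h : Summable fun k : ℕ+ => 1 / (k : ℝ) ^ (1 + (d : ℝ) / 2) :=
    summable_one_div_cycleLength_rpow_iff.2 (by linarith)
  exact (h.mul_left (1 / (4 * Real.pi * β) ^ ((d : ℝ) / 2))).congr fun k => one_div_mul_one_div ..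

lemma exp_mul_cycleLength_le_one (hβ : 0 < β) {s : ℝ} (hs : s ≤ 0) (k : ℕ+) :
    Real.exp (β * s * k) ≤ 1 :=
  Real.exp_le_one_iff.2 <| mul_nonpos_of_nonpos_of_nonneg
    (mul_nonpos_of_nonneg_of_nonpos hβ.le hs) (cycleLength_pos k).le

lemma summable_cycleWeight_mul_exp (hd : 1 ≤ d) (hβ : 0 < β) {s : ℝ} (hs : s ≤ 0) :
    Summable fun k : ℕ+ => cycleWeight d β k * Real.exp (β * s * k) :=
  (summable_cycleWeight hd β).of_nonneg_of_le
    (fun k => mul_nonneg (cycleWeight_pos hβ k).le (Real.exp_pos _).le) fun k =>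
    mul_le_of_le_one_right (cycleWeight_pos hβ k).le (exp_mul_cycleLength_le_one hβ hs k)

/-- The density `∑_k k q_k e^{β s k}` of the ideal gas, the derivative of its pressure in `s`. It is
used at `s < 0`, where the series converges in every dimension. -/
noncomputable def idealDensity (d : ℕ) (β s : ℝ) : ℝ :=
  ∑' k : ℕ+, k * cycleWeight d β k * Real.exp (β * s * k)

lemma idealDensity_term_pos (hβ : 0 < β) (s : ℝ) (k : ℕ+) :
    0 < k * cycleWeight d β k * Real.exp (β * s * k) :=
  mul_pos (mul_pos (cycleLength_pos k) (cycleWeight_pos hβ k)) (Real.exp_pos _)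

lemma summable_idealDensity (hβ : 0 < β) {s : ℝ} (hs : s < 0) :
    Summable fun k : ℕ+ => k * cycleWeight d β k * Real.exp (β * s * k) := by
  have hgeom : Summable fun k : ℕ+ => Real.exp (β * s) ^ (k : ℕ) :=
    (summable_geometric_of_lt_one (Real.exp_pos _).le
      (Real.exp_lt_one_iff.2 (mul_neg_of_pos_of_neg hβ hs))).comp_injective PNat.coe_injective
  refine (hgeom.mul_left (1 / (4 * Real.pi * β) ^ ((d : ℝ) / 2))).of_nonneg_of_le
    (fun k => (idealDensity_term_pos hβ s k).le) fun k => ?_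
  rw [← Real.exp_nat_mul, mul_comm ((k : ℕ) : ℝ) (β * s)]
  exact mul_le_mul_of_nonneg_right (mul_cycleWeight_le hβ k) (Real.exp_pos _).le

lemma idealPressure_nonneg (hβ : 0 < β) (s : ℝ) : 0 ≤ idealPressure d β s :=
  mul_nonneg (by positivity) (tsum_nonneg fun k =>
    mul_nonneg (cycleWeight_pos hβ k).le (Real.exp_pos _).le)

lemma continuousOn_idealPressure (hd : 1 ≤ d) (hβ : 0 < β) :
    ContinuousOn (idealPressure d β) (Iic 0) := by
  refine continuousOn_const.mul <| continuousOn_tsum (u := cycleWeight d β) (fun k => by fun_prop)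
    (summable_cycleWeight hd β) fun k s hs => ?_
  rw [Real.norm_of_nonneg (mul_nonneg (cycleWeight_pos hβ k).le (Real.exp_pos _).le)]
  exact mul_le_of_le_one_right (cycleWeight_pos hβ k).le (exp_mul_cycleLength_le_one hβ hs k)

lemma hasDerivAt_idealPressure (hd : 1 ≤ d) (hβ : 0 < β) {s : ℝ} (hs : s < 0) :
    HasDerivAt (idealPressure d β) (idealDensity d β s) s := by
  have hs2 : s / 2 < 0 := by linarith
  have hmem : s ∈ Iio (s / 2) := mem_Iio.2 (by linarith)
  have hterm : ∀ (k : ℕ+), ∀ t ∈ Iio (s / 2),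
      HasDerivAt (fun z => cycleWeight d β k * Real.exp (β * z * k))
        (β * (k * cycleWeight d β k * Real.exp (β * t * k))) t := fun k t _ =>
    ((((hasDerivAt_id t).const_mul β).mul_const (k : ℝ)).exp.const_mul _).congr_deriv
      (by simp only [id]; ring)
  have hbound : ∀ (k : ℕ+), ∀ t ∈ Iio (s / 2),
      ‖β * (k * cycleWeight d β k * Real.exp (β * t * k))‖ ≤
        β * (k * cycleWeight d β k * Real.exp (β * (s / 2) * k)) := fun k t ht => by
    have hw := cycleWeight_pos (d := d) hβ k
    have := cycleLength_pos k
    have hts : t ≤ s / 2 := (mem_Iio.1 ht).le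
    rw [Real.norm_of_nonneg (by positivity)]
    gcongr
  have hsum := hasDerivAt_tsum_of_isPreconnected ((summable_idealDensity hβ hs2).mul_left β)
    isOpen_Iio isPreconnected_Iio hterm hbound hmem (summable_cycleWeight_mul_exp hd hβ hs.le) hmem
  refine (hsum.const_mul (1 / β)).congr_deriv ?_
  rw [tsum_mul_left, ← mul_assoc, one_div_mul_cancel hβ.ne', one_mul, idealDensity]

lemma deriv_idealPressure (hd : 1 ≤ d) (hβ : 0 < β) {s : ℝ} (hs : s < 0) :
    deriv (idealPressure d β) s = idealDensity d β s :=
  (hasDerivAt_idealPressure hd hβ hs).deriv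

lemma idealDensity_pos (hβ : 0 < β) {s : ℝ} (hs : s < 0) : 0 < idealDensity d β s :=
  (summable_idealDensity hβ hs).tsum_pos (fun k => (idealDensity_term_pos hβ s k).le) 1
    (idealDensity_term_pos hβ s 1)

lemma strictMonoOn_idealDensity (hβ : 0 < β) : StrictMonoOn (idealDensity d β) (Iio 0) := by
  intro s hs t ht hst
  have hterm : ∀ k : ℕ+, k * cycleWeight d β k * Real.exp (β * s * k) <
      k * cycleWeight d β k * Real.exp (β * t * k) := fun k => by
    have hw := cycleWeight_pos (d := d) hβ k
    have := cycleLength_pos k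
    gcongr
  exact Summable.tsum_lt_tsum (i := 1) (fun k => (hterm k).le) (hterm 1)
    (summable_idealDensity hβ hs) (summable_idealDensity hβ ht)

lemma strictConvexOn_idealDensity (hβ : 0 < β) :
    StrictConvexOn ℝ (Iio 0) (idealDensity d β) := by
  refine ⟨convex_Iio 0, fun s hs t ht hst u v hu hv huv => ?_⟩
  have hmem : u • s + v • t ∈ Iio (0 : ℝ) := (convex_Iio 0) hs ht hu.le hv.le huv
  have hterm : ∀ k : ℕ+, k * cycleWeight d β k * Real.exp (β * (u • s + v • t) * k) <
      u * (k * cycleWeight d β k * Real.exp (β * s * k)) +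
        v * (k * cycleWeight d β k * Real.exp (β * t * k)) := fun k => by
    have hk := cycleLength_pos k
    have hne : β * s * k ≠ β * t * k := fun h =>
      hst (mul_left_cancel₀ hβ.ne' (mul_right_cancel₀ hk.ne' h))
    have hexp := strictConvexOn_exp.2 (mem_univ (β * s * k)) (mem_univ (β * t * k)) hne hu hv huv
    simp only [smul_eq_mul] at hexp ⊢
    have hmul := mul_lt_mul_of_pos_left hexp (mul_pos hk (cycleWeight_pos (d := d) hβ k))
    rw [show β * (u * s + v * t) * k = u * (β * s * k) + v * (β * t * k) by ring]
    linarith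
  have hS := (summable_idealDensity (d := d) hβ hs).mul_left u
  have hT := (summable_idealDensity (d := d) hβ ht).mul_left v
  have hlt := Summable.tsum_lt_tsum (i := 1) (fun k => (hterm k).le) (hterm 1)
    (summable_idealDensity hβ hmem) (hS.add hT)
  rwa [hS.tsum_add hT, tsum_mul_left, tsum_mul_left] at hlt

lemma continuousOn_idealDensity (hβ : 0 < β) : ContinuousOn (idealDensity d β) (Iio 0) :=
  (strictConvexOn_idealDensity hβ).convexOn.continuousOn isOpen_Iio

lemma idealDensity_add_le (hβ : 0 < β) {s t : ℝ} (hs : s < 0) (ht : t ≤ 0) :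
    idealDensity d β (s + t) ≤ Real.exp (β * t) * idealDensity d β s := by
  unfold idealDensity
  rw [← tsum_mul_left]
  refine (summable_idealDensity hβ (by linarith)).tsum_le_tsum (fun k => ?_)
    ((summable_idealDensity hβ hs).mul_left _)
  have hβt : β * t ≤ 0 := mul_nonpos_of_nonneg_of_nonpos hβ.le ht
  have hexp : Real.exp (β * t * k) ≤ Real.exp (β * t) :=
    Real.exp_le_exp.2 (mul_le_of_one_le_right hβt (one_le_cycleLength k))
  calc k * cycleWeight d β k * Real.exp (β * (s + t) * k)
      = Real.exp (β * t * k) * (k * cycleWeight d β k * Real.exp (β * s * k)) := by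
        rw [show β * (s + t) * k = β * t * k + β * s * k by ring, Real.exp_add]
        ring
    _ ≤ Real.exp (β * t) * (k * cycleWeight d β k * Real.exp (β * s * k)) :=
        mul_le_mul_of_nonneg_right hexp (idealDensity_term_pos hβ s k).le

lemma tendsto_idealDensity_atBot (hβ : 0 < β) : Tendsto (idealDensity d β) atBot (𝓝 0) := by
  have hexp : Tendsto (fun s : ℝ => Real.exp (β * (s + 1))) atBot (𝓝 0) :=
    Real.tendsto_exp_atBot.comp
      ((tendsto_atBot_add_const_right _ 1 tendsto_id).const_mul_atBot hβ)
  have hbound := hexp.mul_const (idealDensity d β (-1))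
  rw [zero_mul] at hbound
  refine squeeze_zero' ?_ ?_ hbound
  · filter_upwards [eventually_lt_atBot 0] with s hs using (idealDensity_pos hβ hs).le
  · filter_upwards [eventually_le_atBot (-1)] with s hs
    simpa only [neg_add_cancel_comm_assoc] using
      idealDensity_add_le (d := d) hβ (s := -1) (t := s + 1) (by norm_num) (by linarith)

lemma exists_idealDensity_lt (hβ : 0 < β) {x : ℝ} (hx : 0 < x) :
    ∃ s < 0, idealDensity d β s < x :=
  (((tendsto_idealDensity_atBot hβ).eventually (gt_mem_nhds hx)).and
    (eventually_lt_atBot 0)).exists.imp fun _ h => h.symm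

lemma exists_idealDensity_eq (hβ : 0 < β) {x s : ℝ} (hx : 0 < x) (hs : s < 0)
    (h : x ≤ idealDensity d β s) : ∃ t < 0, idealDensity d β t = x := by
  obtain ⟨r, hr, hrx⟩ := exists_idealDensity_lt (d := d) hβ hx
  exact isPreconnected_Iio.intermediate_value (a := r) (b := s) hr hs
    (continuousOn_idealDensity hβ) ⟨hrx.le, h⟩

lemma sum_mul_cycleWeight_le (hβ : 0 < β) {x : ℝ} (h : ∀ s < 0, idealDensity d β s ≤ x)
    (J : Finset ℕ+) : ∑ k ∈ J, k * cycleWeight d β k ≤ x := by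
  have hcont : Continuous fun s : ℝ => ∑ k ∈ J, k * cycleWeight d β k * Real.exp (β * s * k) := by
    fun_prop
  have hlim : Tendsto (fun s : ℝ => ∑ k ∈ J, k * cycleWeight d β k * Real.exp (β * s * k))
      (𝓝[<] 0) (𝓝 (∑ k ∈ J, k * cycleWeight d β k)) := by
    simpa only [mul_zero, zero_mul, Real.exp_zero, mul_one] using
      (hcont.tendsto 0).mono_left nhdsWithin_le_nhds
  refine le_of_tendsto hlim ?_
  filter_upwards [self_mem_nhdsWithin] with s hs
  exact ((summable_idealDensity hβ hs).sum_le_tsum J fun k _ =>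
    (idealDensity_term_pos hβ s k).le).trans (h s hs)

lemma idealDensity_le_of_criticalDensity_le (hβ : 0 < β) {x s : ℝ}
    (h : criticalDensity d β ≤ (x : EReal)) (hs : s < 0) : idealDensity d β s ≤ x := by
  unfold criticalDensity at h
  split_ifs at h with h3
  · have h3' : (3 : ℝ) ≤ d := by exact_mod_cast h3
    have hsum : Summable fun k : ℕ+ => 1 / (k : ℝ) ^ ((d : ℝ) / 2) :=
      summable_one_div_cycleLength_rpow_iff.2 (by linarith)
    refine le_trans ?_ (EReal.coe_le_coe_iff.1 h)
    rw [idealDensity, ← tsum_mul_left]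
    refine (summable_idealDensity hβ hs).tsum_le_tsum (fun k => ?_) (hsum.mul_left _)
    rw [← mul_cycleWeight hβ]
    exact mul_le_of_le_one_right (mul_pos (cycleLength_pos k) (cycleWeight_pos hβ k)).le
      (exp_mul_cycleLength_le_one hβ hs.le k)
  · exact absurd (top_le_iff.1 h) (EReal.coe_ne_top x)

lemma criticalDensity_le_of_forall_idealDensity_le (hβ : 0 < β) {x : ℝ}
    (h : ∀ s < 0, idealDensity d β s ≤ x) : criticalDensity d β ≤ (x : EReal) := by
  have := Real.pi_pos
  have hc : 1 / (4 * Real.pi * β) ^ ((d : ℝ) / 2) ≠ 0 := by positivity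
  have hfin := sum_mul_cycleWeight_le hβ h
  have hsum : Summable fun k : ℕ+ => (k : ℝ) * cycleWeight d β k :=
    summable_of_sum_le (fun k => (mul_pos (cycleLength_pos k) (cycleWeight_pos hβ k)).le) hfin
  simp_rw [mul_cycleWeight hβ] at hsum hfin
  have hd : 1 < (d : ℝ) / 2 :=
    summable_one_div_cycleLength_rpow_iff.1 ((summable_mul_left_iff hc).1 hsum)
  have h3 : 3 ≤ d := Nat.succ_le_of_lt <| by exact_mod_cast (by linarith : (2 : ℝ) < d)
  rw [criticalDensity, if_pos h3, EReal.coe_le_coe_iff, ← tsum_mul_left]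
  exact hsum.tsum_le_of_sum_le hfin

lemma criticalDensity_le_iff (hβ : 0 < β) (x : ℝ) :
    criticalDensity d β ≤ (x : EReal) ↔ ∀ s < 0, idealDensity d β s ≤ x :=
  ⟨fun h _ hs => idealDensity_le_of_criticalDensity_le hβ h hs,
    criticalDensity_le_of_forall_idealDensity_le hβ⟩

end IdealGas

/-! ### Conjugate potentials and the free energy -/

/-- The potential `s ≤ 0` is conjugate to the density `x`: the linear functional with slope `x`
touches the ideal gas pressure, extended by `+∞` to positive potentials, at `s`. For `x > 0` this
characterises `s = s_β(x)`. -/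
structure IsConjugate (d : ℕ) (β x s : ℝ) : Prop where
  nonpos : s ≤ 0
  density_eq : s < 0 → idealDensity d β s = x
  density_le : s = 0 → ∀ t < 0, idealDensity d β t ≤ x

section Conjugate

variable {d : ℕ} {β x s t : ℝ}

lemma isConjugate_idealDensity (hs : s < 0) : IsConjugate d β (idealDensity d β s) s :=
  ⟨hs.le, fun _ => rfl, fun h => absurd h hs.ne⟩

lemma isConjugate_zero (h : ∀ t < 0, idealDensity d β t ≤ x) : IsConjugate d β x 0 :=
  ⟨le_rfl, fun h0 => absurd h0 (lt_irrefl 0), fun _ => h⟩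

namespace IsConjugate

lemma density_le_of_lt (hβ : 0 < β) (h : IsConjugate d β x s) (ht : t < s) :
    idealDensity d β t ≤ x := by
  rcases h.nonpos.lt_or_eq with hs | hs
  · exact h.density_eq hs ▸ (strictMonoOn_idealDensity hβ (ht.trans hs) hs ht).le
  · exact h.density_le hs t (hs ▸ ht)

lemma pos (hβ : 0 < β) (h : IsConjugate d β x s) : 0 < x :=
  (idealDensity_pos hβ (by linarith [h.nonpos])).trans_le
    (h.density_le_of_lt hβ (show s - 1 < s by linarith))

lemma le_of_le (hβ : 0 < β) {x' s' : ℝ} (h : IsConjugate d β x s) (h' : IsConjugate d β x' s')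
    (hx : x ≤ x') : s ≤ s' := by
  by_contra! hlt
  obtain ⟨t, ht', ht⟩ := exists_between hlt
  have hs' : s' < 0 := hlt.trans_le h.nonpos
  have hlt' := strictMonoOn_idealDensity (d := d) hβ hs' (ht.trans_le h.nonpos) ht'
  rw [h'.density_eq hs'] at hlt'
  linarith [h.density_le_of_lt hβ ht]

lemma unique (hβ : 0 < β) {s' : ℝ} (h : IsConjugate d β x s) (h' : IsConjugate d β x s') :
    s = s' :=
  le_antisymm (h.le_of_le hβ h' le_rfl) (h'.le_of_le hβ h le_rfl)

lemma idealPressure_add_mul_le (hd : 1 ≤ d) (hβ : 0 < β) (h : IsConjugate d β x s) (ht : t ≤ 0) :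
    idealPressure d β s + x * (t - s) ≤ idealPressure d β t := by
  have hmvt : ∀ u v : ℝ, u < v → v ≤ 0 → ∃ ξ ∈ Ioo u v,
      idealDensity d β ξ = (idealPressure d β v - idealPressure d β u) / (v - u) :=
    fun u v huv hv => exists_hasDerivAt_eq_slope _ _ huv
      ((continuousOn_idealPressure hd hβ).mono fun z hz => hz.2.trans hv)
      fun z hz => hasDerivAt_idealPressure hd hβ (hz.2.trans_le hv)
  rcases lt_trichotomy t s with hts | rfl | hst
  · obtain ⟨ξ, hξ, hslope⟩ := hmvt t s hts h.nonpos
    have hle := h.density_le_of_lt hβ hξ.2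
    rw [hslope, div_le_iff₀ (by linarith)] at hle
    linarith
  · simp only [sub_self, mul_zero, add_zero, le_refl]
  · obtain ⟨ξ, hξ, hslope⟩ := hmvt s t hst ht
    have hs : s < 0 := hst.trans_le ht
    have hle := (strictMonoOn_idealDensity (d := d) hβ hs (hξ.2.trans_le ht) hξ.1).le
    rw [h.density_eq hs, hslope, le_div_iff₀ (by linarith)] at hle
    linarith

end IsConjugate

lemma le_freeEnergy (hβ : 0 < β) (hx : 0 ≤ x) (hs : s ≤ 0) :
    s * x - idealPressure d β s ≤ freeEnergy d β x := by
  refine le_csSup ⟨0, ?_⟩ ⟨s, hs, rfl⟩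
  rintro _ ⟨t, ht, rfl⟩
  exact (sub_le_self _ (idealPressure_nonneg hβ t)).trans
    (mul_nonpos_of_nonpos_of_nonneg (mem_Iic.1 ht) hx)

lemma IsConjugate.freeEnergy_eq (hd : 1 ≤ d) (hβ : 0 < β) (h : IsConjugate d β x s) :
    freeEnergy d β x = s * x - idealPressure d β s := by
  refine le_antisymm (csSup_le (nonempty_Iic.image _) ?_) (le_freeEnergy hβ (h.pos hβ).le h.nonpos)
  rintro _ ⟨t, ht, rfl⟩
  have := h.idealPressure_add_mul_le hd hβ (mem_Iic.1 ht)
  linarith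

lemma isConjugate_sBeta (hd : 1 ≤ d) (hβ : 0 < β) (hx : 0 < x) :
    IsConjugate d β x (sBeta d β x) := by
  unfold sBeta
  split_ifs with hc
  · exact isConjugate_zero ((criticalDensity_le_iff hβ x).1 hc)
  · rw [criticalDensity_le_iff hβ] at hc
    push Not at hc
    obtain ⟨r, hr, hxr⟩ := hc
    obtain ⟨s, hs, rfl⟩ := exists_idealDensity_eq hβ hx hr hxr.le
    have hset : {t | t < 0 ∧ deriv (idealPressure d β) t = idealDensity d β s} = {s} := by
      ext t
      refine ⟨fun ⟨ht, he⟩ => (strictMonoOn_idealDensity (d := d) hβ).injOn ht hs ?_, ?_⟩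
      · rwa [deriv_idealPressure hd hβ ht] at he
      · rintro rfl
        exact ⟨hs, deriv_idealPressure hd hβ hs⟩
    rw [hset, csSup_singleton]
    exact isConjugate_idealDensity hs

lemma sBeta_eq_iff (hd : 1 ≤ d) (hβ : 0 < β) (hx : 0 < x) :
    sBeta d β x = s ↔ IsConjugate d β x s :=
  ⟨fun h => h ▸ isConjugate_sBeta hd hβ hx, fun h => (isConjugate_sBeta hd hβ hx).unique hβ h⟩

end Conjugate

/-! ### The subcritical pressure -/

/-- The effective potential of the short cycles at total potential `ν`: the minimiser of
`(ν - s)² / (2 * a) + p₀(β, s)` over `s ≤ 0`, encoded through the sign of the derivative. -/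
noncomputable def effectivePotential (d : ℕ) (β a ν : ℝ) : ℝ :=
  sSup {s : ℝ | s < 0 ∧ a * idealDensity d β s + s < ν}

/-- The density of short cycles that is optimal at total potential `ν`. -/
noncomputable def optimalDensity (d : ℕ) (β a ν : ℝ) : ℝ := (ν - effectivePotential d β a ν) / a

section SubcriticalPressure

variable {d : ℕ} {β a ν ν' s : ℝ}

lemma continuousOn_mul_idealDensity_add (hβ : 0 < β) :
    ContinuousOn (fun s => a * idealDensity d β s + s) (Iio 0) :=
  (continuousOn_const.mul (continuousOn_idealDensity hβ)).add continuousOn_id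

lemma strictMonoOn_mul_idealDensity_add (hβ : 0 < β) (ha : 0 < a) :
    StrictMonoOn (fun s => a * idealDensity d β s + s) (Iio 0) := fun _ hs _ ht hst =>
  add_lt_add (mul_lt_mul_of_pos_left (strictMonoOn_idealDensity hβ hs ht hst) ha) hst

lemma effectivePotential_set_nonempty (hβ : 0 < β) :
    {s : ℝ | s < 0 ∧ a * idealDensity d β s + s < ν}.Nonempty := by
  have hlim : Tendsto (fun s => a * idealDensity d β s + s) atBot atBot :=
    ((tendsto_idealDensity_atBot hβ).const_mul a).add_atBot tendsto_id
  exact ((eventually_lt_atBot 0).and (hlim.eventually (eventually_lt_atBot ν))).exists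

lemma effectivePotential_nonpos (hβ : 0 < β) : effectivePotential d β a ν ≤ 0 :=
  csSup_le (effectivePotential_set_nonempty hβ) fun _ hs => hs.1.le

lemma lt_effectivePotential_iff (hβ : 0 < β) (ha : 0 < a) (hs : s < 0) :
    s < effectivePotential d β a ν ↔ a * idealDensity d β s + s < ν := by
  constructor
  · intro h
    obtain ⟨t, ⟨ht, htν⟩, hst⟩ := exists_lt_of_lt_csSup (effectivePotential_set_nonempty hβ) h
    exact (strictMonoOn_mul_idealDensity_add hβ ha hs ht hst).trans htν
  · intro h
    have hev : ∀ᶠ t in 𝓝[>] s, a * idealDensity d β t + t < ν :=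
      (((continuousOn_mul_idealDensity_add hβ).continuousAt (Iio_mem_nhds hs)).eventually
        (gt_mem_nhds h)).filter_mono nhdsWithin_le_nhds
    obtain ⟨t, htν, hst, ht⟩ := (hev.and (Ioo_mem_nhdsGT hs)).exists
    exact hst.trans_le (le_csSup ⟨0, fun _ hr => hr.1.le⟩ ⟨ht, htν⟩)

lemma mul_idealDensity_effectivePotential (hβ : 0 < β) (ha : 0 < a)
    (h : effectivePotential d β a ν < 0) :
    a * idealDensity d β (effectivePotential d β a ν) + effectivePotential d β a ν = ν := by
  refine le_antisymm ?_ (not_lt.1 ((lt_effectivePotential_iff hβ ha h).not.1 (lt_irrefl _)))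
  have hcont := (continuousOn_mul_idealDensity_add (d := d) (a := a) hβ).continuousAt
    (Iio_mem_nhds h)
  refine le_of_tendsto (hcont.tendsto.mono_left
    (nhdsWithin_le_nhds (s := Iio (effectivePotential d β a ν)))) ?_
  filter_upwards [self_mem_nhdsWithin] with s hs
  exact ((lt_effectivePotential_iff hβ ha (hs.trans h)).1 hs).le

lemma isConjugate_effectivePotential (hβ : 0 < β) (ha : 0 < a) (ν : ℝ) :
    IsConjugate d β (optimalDensity d β a ν) (effectivePotential d β a ν) := by
  refine ⟨effectivePotential_nonpos hβ, fun h => ?_, fun h t ht => ?_⟩ <;> unfold optimalDensity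
  · rw [eq_div_iff ha.ne']
    linarith [mul_idealDensity_effectivePotential hβ ha h]
  · rw [h, sub_zero, le_div_iff₀ ha]
    refine le_of_forall_gt_imp_ge_of_dense fun u hu => ?_
    have hr : max t (ν - u) < 0 := max_lt ht (by linarith)
    have hlt := (lt_effectivePotential_iff hβ ha hr).1 (h ▸ hr)
    have hmono := (strictMonoOn_idealDensity (d := d) hβ).monotoneOn ht hr (le_max_left _ _)
    have hmul := mul_le_mul_of_nonneg_left hmono ha.le
    linarith [le_max_right t (ν - u)]

lemma effectivePotential_eq_of_isConjugate (hβ : 0 < β) (ha : 0 < a)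
    (h : IsConjugate d β ((ν - s) / a) s) : effectivePotential d β a ν = s := by
  refine le_antisymm ?_ ?_ <;> by_contra! hlt
  · have hs : s < 0 := hlt.trans_le (effectivePotential_nonpos hβ)
    have hlt' := (lt_effectivePotential_iff hβ ha hs).1 hlt
    rw [h.density_eq hs, mul_div_cancel₀ _ ha.ne'] at hlt'
    linarith
  · have heq := mul_idealDensity_effectivePotential hβ ha (hlt.trans_le h.nonpos)
    have hle := h.density_le_of_lt hβ hlt
    rw [le_div_iff₀ ha] at hle
    linarith

lemma optimalDensity_pos (hβ : 0 < β) (ha : 0 < a) (ν : ℝ) : 0 < optimalDensity d β a ν :=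
  (isConjugate_effectivePotential hβ ha ν).pos hβ

lemma effectivePotential_mono (hβ : 0 < β) (ha : 0 < a) : Monotone (effectivePotential d β a) := by
  intro ν ν' hν
  by_contra! hlt
  have h0 : effectivePotential d β a ν' < 0 := hlt.trans_le (effectivePotential_nonpos hβ)
  exact lt_irrefl _ ((lt_effectivePotential_iff hβ ha h0).2
    (((lt_effectivePotential_iff hβ ha h0).1 hlt).trans_le hν))

lemma effectivePotential_lt_of_lt (hβ : 0 < β) (ha : 0 < a) (hν : ν < ν')
    (h : effectivePotential d β a ν < 0) :
    effectivePotential d β a ν < effectivePotential d β a ν' := by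
  rwa [lt_effectivePotential_iff hβ ha h, mul_idealDensity_effectivePotential hβ ha h]

lemma optimalDensity_mono (hβ : 0 < β) (ha : 0 < a) : Monotone (optimalDensity d β a) := by
  intro ν ν' hν
  by_contra! hlt
  have hle := (isConjugate_effectivePotential (d := d) hβ ha ν').le_of_le hβ
    (isConjugate_effectivePotential hβ ha ν) hlt.le
  unfold optimalDensity at hlt
  rw [div_lt_div_iff_of_pos_right ha] at hlt
  linarith

lemma pSub_integrand_effectivePotential_le (hd : 1 ≤ d) (hβ : 0 < β) (ha : 0 < a) (ν : ℝ)
    (hs : s ≤ 0) :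
    (ν - effectivePotential d β a ν) ^ 2 / (2 * a) +
        idealPressure d β (effectivePotential d β a ν) ≤
      (ν - s) ^ 2 / (2 * a) + idealPressure d β s := by
  have htangent :=
    (isConjugate_effectivePotential (d := d) hβ ha ν).idealPressure_add_mul_le hd hβ hs
  unfold optimalDensity at htangent
  set σ := effectivePotential d β a ν
  have hsq : (ν - s) ^ 2 / (2 * a) - (ν - σ) ^ 2 / (2 * a) + (ν - σ) / a * (s - σ) =
      (s - σ) ^ 2 / (2 * a) := by
    field_simp
    ring
  have hnonneg : 0 ≤ (s - σ) ^ 2 / (2 * a) := by positivity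
  linarith

lemma pSub_eq (hd : 1 ≤ d) (hβ : 0 < β) (ha : 0 < a) (ν : ℝ) :
    pSub d β a ν = (ν - effectivePotential d β a ν) ^ 2 / (2 * a) +
      idealPressure d β (effectivePotential d β a ν) := by
  set f : ℝ → ℝ := fun s => (ν - s) ^ 2 / (2 * a) + idealPressure d β s
  set σ := effectivePotential d β a ν
  have hlower : f σ ∈ lowerBounds (f '' Iio 0) := by
    rintro _ ⟨s, hs, rfl⟩
    exact pSub_integrand_effectivePotential_le hd hβ ha ν (mem_Iio.1 hs).le
  refine le_antisymm ?_ (le_csInf (nonempty_Iio.image f) hlower)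
  have hcont : ContinuousOn f (Iic 0) :=
    (by fun_prop : Continuous fun s : ℝ => (ν - s) ^ 2 / (2 * a)).continuousOn.add
      (continuousOn_idealPressure hd hβ)
  have hσ : σ ∈ closure (Iio (0 : ℝ)) := by
    rw [closure_Iio]
    exact effectivePotential_nonpos hβ
  have := mem_closure_iff_nhdsWithin_neBot.1 hσ
  refine ge_of_tendsto ((hcont σ (effectivePotential_nonpos hβ)).mono Iio_subset_Iic_self) ?_
  filter_upwards [self_mem_nhdsWithin] with s hs
  exact csInf_le ⟨_, hlower⟩ ⟨s, hs, rfl⟩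

lemma pSub_le (hd : 1 ≤ d) (hβ : 0 < β) (ha : 0 < a) (ν : ℝ) (hs : s ≤ 0) :
    pSub d β a ν ≤ (ν - s) ^ 2 / (2 * a) + idealPressure d β s :=
  (pSub_eq hd hβ ha ν).trans_le (pSub_integrand_effectivePotential_le hd hβ ha ν hs)

lemma pSub_le_add (hd : 1 ≤ d) (hβ : 0 < β) (ha : 0 < a) (ν ν' : ℝ) :
    pSub d β a ν' ≤ pSub d β a ν + (ν' - ν) * optimalDensity d β a ν +
      (ν' - ν) ^ 2 / (2 * a) := by
  refine (pSub_le hd hβ ha ν' (effectivePotential_nonpos (d := d) (a := a) (ν := ν) hβ)).trans_eq ?_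
  rw [pSub_eq hd hβ ha ν, optimalDensity]
  field_simp
  ring

lemma hasDerivAt_pSub (hd : 1 ≤ d) (hβ : 0 < β) (ha : 0 < a) (ν : ℝ) :
    HasDerivAt (pSub d β a) (optimalDensity d β a ν) ν := by
  have hbound : ∀ ν' : ℝ, |pSub d β a ν' - pSub d β a ν - (ν' - ν) * optimalDensity d β a ν| ≤
      1 / (2 * a) * |(ν' - ν) ^ 2| := fun ν' => by
    have hmono : 0 ≤ (ν' - ν) * (optimalDensity d β a ν' - optimalDensity d β a ν) := by
      rcases le_total ν ν' with h | h
      · exact mul_nonneg (by linarith) (sub_nonneg.2 (optimalDensity_mono hβ ha h))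
      · exact mul_nonneg_of_nonpos_of_nonpos (by linarith)
          (sub_nonpos.2 (optimalDensity_mono hβ ha h))
    have hupper := pSub_le_add hd hβ ha ν ν'
    have hlower := pSub_le_add hd hβ ha ν' ν
    have hsq : (ν - ν') ^ 2 / (2 * a) = (ν' - ν) ^ 2 / (2 * a) := by ring
    have hcoef : 1 / (2 * a) * (ν' - ν) ^ 2 = (ν' - ν) ^ 2 / (2 * a) := by ring
    rw [abs_of_nonneg (sq_nonneg (ν' - ν)), hcoef, abs_le]
    constructor <;> linarith
  rw [hasDerivAt_iff_isLittleO]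
  refine Asymptotics.IsBigO.trans_isLittleO
    (.of_bound (1 / (2 * a)) (Eventually.of_forall fun ν' => ?_))
    (Asymptotics.isLittleO_pow_sub_sub ν one_lt_two)
  simpa only [Real.norm_eq_abs, smul_eq_mul, abs_pow, abs_abs] using hbound ν'

end SubcriticalPressure

/-! ### The reduced functional -/

/-- The supremum over `x ≥ 0` of the pressure functional at a fixed density `y` of long cycles. -/
noncomputable def reducedFunctional (d : ℕ) (β a b μ y : ℝ) : ℝ :=
  pSub d β a (μ - a * y) + μ * y - (a - b) / 2 * y ^ 2

/-- The maximum of the reduced functional over a set `Y` of densities of long cycles. -/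
noncomputable def maxPressure (d : ℕ) (β a b : ℝ) (Y : Set ℝ) (μ : ℝ) : ℝ :=
  sSup (reducedFunctional d β a b μ '' Y)

/-- The densities of long cycles that are admissible for `κ`. -/
def longDensities (κ : ℝ≥0∞) : Set ℝ := {y | 0 ≤ y ∧ (y = 0 ∨ κ ≤ ENNReal.ofReal y)}

section ReducedFunctional

variable {d : ℕ} {β a b μ x y : ℝ} {Y : Set ℝ} {κ : ℝ≥0∞}

lemma reducedFunctional_zero : reducedFunctional d β a b μ 0 = pSub d β a μ := by
  simp [reducedFunctional]

lemma pressureFunctional_le (hd : 1 ≤ d) (hβ : 0 < β) (ha : 0 < a) (b μ y : ℝ) (hx : 0 ≤ x) :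
    pressureFunctional d β μ a b (x, y) ≤ reducedFunctional d β a b μ y -
      a / 2 * (x - optimalDensity d β a (μ - a * y)) ^ 2 := by
  have hle := le_freeEnergy (d := d) hβ hx
    (effectivePotential_nonpos (d := d) (a := a) (ν := μ - a * y) hβ)
  unfold reducedFunctional pressureFunctional optimalDensity
  rw [pSub_eq hd hβ ha]
  set σ := effectivePotential d β a (μ - a * y)
  have hsq : μ * (x + y) - a / 2 * (x + y) ^ 2 + b / 2 * y ^ 2 - (σ * x - idealPressure d β σ) =
      (μ - a * y - σ) ^ 2 / (2 * a) + idealPressure d β σ + μ * y - (a - b) / 2 * y ^ 2 -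
        a / 2 * (x - (μ - a * y - σ) / a) ^ 2 := by
    field_simp
    ring
  linarith

lemma pressureFunctional_optimalDensity (hd : 1 ≤ d) (hβ : 0 < β) (ha : 0 < a) (b μ y : ℝ) :
    pressureFunctional d β μ a b (optimalDensity d β a (μ - a * y), y) =
      reducedFunctional d β a b μ y := by
  unfold reducedFunctional pressureFunctional
  rw [pSub_eq hd hβ ha, (isConjugate_effectivePotential hβ ha _).freeEnergy_eq hd hβ]
  unfold optimalDensity
  field_simp
  ring

lemma hasDerivAt_reducedFunctional (hd : 1 ≤ d) (hβ : 0 < β) (ha : 0 < a) (b μ y : ℝ) :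
    HasDerivAt (reducedFunctional d β a b μ) (effectivePotential d β a (μ - a * y) + b * y) y := by
  have harg : HasDerivAt (fun z => μ - a * z) (-a) y := by
    simpa using ((hasDerivAt_id y).const_mul a).const_sub μ
  have hsub := (hasDerivAt_pSub (d := d) hd hβ ha (μ - a * y)).comp y harg
  refine ((hsub.add ((hasDerivAt_id y).const_mul μ)).sub
    ((hasDerivAt_pow 2 y).const_mul ((a - b) / 2))).congr_deriv ?_
  unfold optimalDensity
  field_simp
  ring

lemma hasDerivAt_reducedFunctional_potential (hd : 1 ≤ d) (hβ : 0 < β) (ha : 0 < a)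
    (b μ y : ℝ) : HasDerivAt (fun ν => reducedFunctional d β a b ν y)
      (optimalDensity d β a (μ - a * y) + y) μ := by
  have hsub := (hasDerivAt_pSub (d := d) hd hβ ha (μ - a * y)).comp_sub_const μ (a * y)
  simpa [reducedFunctional] using
    (hsub.add ((hasDerivAt_id μ).mul_const y)).sub_const ((a - b) / 2 * y ^ 2)

lemma continuous_reducedFunctional (hd : 1 ≤ d) (hβ : 0 < β) (ha : 0 < a) (b μ : ℝ) :
    Continuous (reducedFunctional d β a b μ) :=
  continuous_iff_continuousAt.2 fun y => (hasDerivAt_reducedFunctional hd hβ ha b μ y).continuousAt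

lemma continuous_reducedFunctional_potential (hd : 1 ≤ d) (hβ : 0 < β) (ha : 0 < a) (b y : ℝ) :
    Continuous fun μ => reducedFunctional d β a b μ y :=
  continuous_iff_continuousAt.2 fun μ =>
    (hasDerivAt_reducedFunctional_potential hd hβ ha b μ y).continuousAt

lemma convexOn_reducedFunctional_potential (hd : 1 ≤ d) (hβ : 0 < β) (ha : 0 < a) (b y : ℝ) :
    ConvexOn ℝ univ fun μ => reducedFunctional d β a b μ y := by
  have hderiv := hasDerivAt_reducedFunctional_potential (d := d) hd hβ ha b (y := y)
  refine Monotone.convexOn_univ_of_deriv (fun μ => (hderiv μ).differentiableAt) fun μ ν hμν => ?_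
  rw [(hderiv μ).deriv, (hderiv ν).deriv]
  exact add_le_add_left (optimalDensity_mono hβ ha (sub_le_sub_right hμν _)) y

lemma tendsto_reducedFunctional_atTop (hd : 1 ≤ d) (hβ : 0 < β) (ha : 0 < a) (hab : b < a)
    (μ : ℝ) : Tendsto (reducedFunctional d β a b μ) atTop atBot := by
  have hbound : ∀ᶠ y in atTop, reducedFunctional d β a b μ y ≤
      idealPressure d β 0 + y * (μ - (a - b) / 2 * y) := by
    filter_upwards [eventually_gt_atTop (μ / a)] with y hy
    have hν : μ - a * y < 0 := by
      rw [div_lt_iff₀ ha] at hy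
      linarith
    have hsub := pSub_le hd hβ ha (μ - a * y) hν.le
    have htangent := (isConjugate_idealDensity hν).idealPressure_add_mul_le hd hβ le_rfl
    have hdensity := mul_pos (idealDensity_pos (d := d) hβ hν) (sub_pos.2 hν)
    rw [sub_self, zero_pow two_ne_zero, zero_div, zero_add] at hsub
    unfold reducedFunctional
    linarith
  refine tendsto_atBot_mono' _ hbound ?_
  refine tendsto_atBot_add_const_left _ _ (tendsto_id.atTop_mul_atBot₀ ?_)
  have hlin : Tendsto (fun y : ℝ => -((a - b) / 2 * y)) atTop atBot :=
    tendsto_neg_atTop_atBot.comp (tendsto_id.const_mul_atTop (by linarith))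
  simpa only [sub_eq_add_neg] using tendsto_atBot_add_const_left _ μ hlin

lemma exists_isMaxOn (hd : 1 ≤ d) (hβ : 0 < β) (ha : 0 < a) (hab : b < a) (hc : IsClosed Y)
    (hne : Y.Nonempty) (h0 : Y ⊆ Ici 0) (μ : ℝ) :
    ∃ y ∈ Y, IsMaxOn (reducedFunctional d β a b μ) Y y := by
  obtain ⟨y₀, hy₀⟩ := hne
  refine (continuous_reducedFunctional hd hβ ha b μ).continuousOn.exists_isMaxOn' hc hy₀ ?_
  obtain ⟨R, hR⟩ := eventually_atTop.1 (tendsto_atBot.1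
    (tendsto_reducedFunctional_atTop (d := d) hd hβ ha hab μ) (reducedFunctional d β a b μ y₀))
  rw [eventually_inf_principal]
  filter_upwards [(isCompact_Icc (a := 0) (b := R)).compl_mem_cocompact] with y hy hyY
  exact hR y (not_lt.1 fun hlt => hy ⟨h0 hyY, hlt.le⟩)

lemma maxPressure_eq (hy : y ∈ Y) (h : IsMaxOn (reducedFunctional d β a b μ) Y y) :
    maxPressure d β a b Y μ = reducedFunctional d β a b μ y :=
  IsGreatest.csSup_eq ⟨mem_image_of_mem _ hy, forall_mem_image.2 h⟩

lemma continuous_maxPressure (hd : 1 ≤ d) (hβ : 0 < β) (ha : 0 < a) (hab : b < a)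
    (hc : IsClosed Y) (hne : Y.Nonempty) (h0 : Y ⊆ Ici 0) :
    Continuous (maxPressure d β a b Y) := by
  suffices h : ConvexOn ℝ univ (maxPressure d β a b Y) from
    continuousOn_univ.1 (h.continuousOn isOpen_univ)
  have hle : ∀ μ, ∀ y ∈ Y, reducedFunctional d β a b μ y ≤ maxPressure d β a b Y μ := by
    intro μ y hy
    obtain ⟨z, hz, hmax⟩ := exists_isMaxOn (d := d) hd hβ ha hab hc hne h0 μ
    exact (hmax hy).trans_eq (maxPressure_eq hz hmax).symm
  refine ⟨convex_univ, fun μ hμ ν hν u v hu hv huv => ?_⟩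
  obtain ⟨y, hy, hmax⟩ := exists_isMaxOn (d := d) hd hβ ha hab hc hne h0 (u • μ + v • ν)
  rw [maxPressure_eq hy hmax]
  refine ((convexOn_reducedFunctional_potential hd hβ ha b y).2 hμ hν hu hv huv).trans ?_
  gcongr
  exacts [hle μ y hy, hle ν y hy]

/-! ### Zeroes of the rate function -/

lemma zero_mem_longDensities (κ : ℝ≥0∞) : 0 ∈ longDensities κ := ⟨le_rfl, .inl rfl⟩

lemma longDensities_subset_Ici (κ : ℝ≥0∞) : longDensities κ ⊆ Ici 0 := fun _ h => h.1

lemma isClosed_longDensities (κ : ℝ≥0∞) : IsClosed (longDensities κ) :=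
  isClosed_Ici.inter <| isClosed_singleton.union <|
    isClosed_Ici.preimage ENNReal.continuous_ofReal

lemma longDensities_zero : longDensities 0 = Ici 0 :=
  Set.ext fun _ => and_iff_left (.inr zero_le)

lemma longDensities_top : longDensities ⊤ = {0} :=
  Set.ext fun _ => ⟨fun h => h.2.resolve_right fun htop =>
    ENNReal.ofReal_ne_top (top_le_iff.1 htop), fun h =>
    mem_singleton_iff.1 h ▸ zero_mem_longDensities ⊤⟩

lemma mem_longDensities_ofReal {κ : ℝ} (hκ : 0 < κ) :
    y ∈ longDensities (ENNReal.ofReal κ) ↔ y = 0 ∨ κ ≤ y := by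
  constructor
  · rintro ⟨hy, hy' | hy'⟩
    exacts [.inl hy', .inr ((ENNReal.ofReal_le_ofReal_iff hy).1 hy')]
  · rintro (rfl | hy)
    exacts [zero_mem_longDensities _, ⟨hκ.le.trans hy, .inr (ENNReal.ofReal_le_ofReal hy)⟩]

lemma exists_isMaxOn_longDensities (hd : 1 ≤ d) (hβ : 0 < β) (ha : 0 < a) (hab : b < a)
    (κ : ℝ≥0∞) (μ : ℝ) :
    ∃ y ∈ longDensities κ, IsMaxOn (reducedFunctional d β a b μ) (longDensities κ) y :=
  exists_isMaxOn hd hβ ha hab (isClosed_longDensities κ) ⟨0, zero_mem_longDensities κ⟩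
    (longDensities_subset_Ici κ) μ

lemma sSup_pressureFunctional_eq (hd : 1 ≤ d) (hβ : 0 < β) (ha : 0 < a) (hy : y ∈ longDensities κ)
    (hmax : IsMaxOn (reducedFunctional d β a b μ) (longDensities κ) y) :
    sSup (pressureFunctional d β μ a b '' admissible κ) = reducedFunctional d β a b μ y := by
  refine IsGreatest.csSup_eq ⟨⟨(optimalDensity d β a (μ - a * y), y),
    ⟨(optimalDensity_pos hβ ha _).le, hy⟩, pressureFunctional_optimalDensity hd hβ ha b μ y⟩, ?_⟩
  rintro _ ⟨⟨x, z⟩, ⟨hx, hz⟩, rfl⟩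
  refine (pressureFunctional_le hd hβ ha b μ z hx).trans ((sub_le_self _ ?_).trans (hmax hz))
  positivity

lemma mem_zeroes_iff {z : ℝ × ℝ} :
    z ∈ zeroes d β μ a b κ ↔ z ∈ admissible κ ∧
      pressureFunctional d β μ a b z = sSup (pressureFunctional d β μ a b '' admissible κ) := by
  simp only [zeroes, rateFunction, mem_ofPred_eq]
  split_ifs with hz
  · rw [EReal.coe_eq_zero, sub_eq_zero, eq_comm, and_iff_right hz]
  · exact iff_of_false (by simp) fun h => hz h.1

lemma zeroes_eq_singleton (hd : 1 ≤ d) (hβ : 0 < β) (ha : 0 < a) (hy : y ∈ longDensities κ)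
    (hmax : IsMaxOn (reducedFunctional d β a b μ) (longDensities κ) y)
    (huniq : ∀ z ∈ longDensities κ,
      IsMaxOn (reducedFunctional d β a b μ) (longDensities κ) z → z = y) :
    zeroes d β μ a b κ = {(optimalDensity d β a (μ - a * y), y)} := by
  ext ⟨x, z⟩
  rw [mem_zeroes_iff, sSup_pressureFunctional_eq hd hβ ha hy hmax, mem_singleton_iff, Prod.mk_inj]
  constructor
  · rintro ⟨⟨hx, hz⟩, heq⟩
    have hle := pressureFunctional_le (d := d) (x := x) hd hβ ha b μ z hx
    have hmul : 0 ≤ a / 2 * (x - optimalDensity d β a (μ - a * z)) ^ 2 := by positivity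
    have hmax' : IsMaxOn (reducedFunctional d β a b μ) (longDensities κ) z :=
      isMaxOn_iff.2 fun w hw => (isMaxOn_iff.1 hmax w hw).trans (by linarith)
    obtain rfl := huniq z hz hmax'
    have hsq : a / 2 * (x - optimalDensity d β a (μ - a * z)) ^ 2 = 0 := by linarith
    rw [mul_eq_zero_iff_left (by positivity), sq_eq_zero_iff, sub_eq_zero] at hsq
    exact ⟨hsq, rfl⟩
  · rintro ⟨rfl, rfl⟩
    exact ⟨⟨(optimalDensity_pos hβ ha _).le, hy⟩, pressureFunctional_optimalDensity hd hβ ha b μ _⟩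

end ReducedFunctional

/-! ### Stationary points -/

/-- The potential `μ` at which `y = -s/b` is a stationary point of the reduced functional, as a
function of the potential `s < 0` of the short cycles. -/
noncomputable def stationaryPotential (d : ℕ) (β a b s : ℝ) : ℝ :=
  a * idealDensity d β s - (a - b) / b * s

/-- The gain in pressure from a density `y` of long cycles over having no long cycles. -/
noncomputable def longCycleGain (d : ℕ) (β a b y μ : ℝ) : ℝ :=
  reducedFunctional d β a b μ y - reducedFunctional d β a b μ 0

section Stationary

variable {d : ℕ} {β a b μ ν κ s t y z : ℝ}

lemma continuousOn_stationaryPotential (hβ : 0 < β) :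
    ContinuousOn (stationaryPotential d β a b) (Iio 0) :=
  (continuousOn_const.mul (continuousOn_idealDensity hβ)).sub
    (continuousOn_const.mul continuousOn_id)

lemma strictConvexOn_stationaryPotential (hβ : 0 < β) (ha : 0 < a) :
    StrictConvexOn ℝ (Iio 0) (stationaryPotential d β a b) := by
  refine ⟨convex_Iio 0, fun s hs t ht hst u v hu hv huv => ?_⟩
  have hlt := mul_lt_mul_of_pos_left
    ((strictConvexOn_idealDensity (d := d) hβ).2 hs ht hst hu hv huv) ha
  simp only [smul_eq_mul, stationaryPotential] at hlt ⊢
  linarith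

lemma stationaryPotential_lt_of_mem_Ioo (hβ : 0 < β) (ha : 0 < a) (ht : t < 0)
    (hsμ : stationaryPotential d β a b s ≤ μ) (htμ : stationaryPotential d β a b t ≤ μ)
    (hz : z ∈ Ioo s t) : stationaryPotential d β a b z < μ := by
  have hst := hz.1.trans hz.2
  exact ((strictConvexOn_stationaryPotential hβ ha).lt_on_openSegment (hst.trans ht) ht hst.ne
    (by rwa [openSegment_eq_Ioo hst])).trans_le (max_le hsμ htμ)

lemma deriv_reducedFunctional_pos_iff (hd : 1 ≤ d) (hβ : 0 < β) (ha : 0 < a) (hb : 0 < b)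
    (hy : 0 < y) : 0 < deriv (reducedFunctional d β a b μ) y ↔
      stationaryPotential d β a b (-(b * y)) < μ := by
  rw [(hasDerivAt_reducedFunctional hd hβ ha b μ y).deriv, ← neg_lt_iff_pos_add,
    lt_effectivePotential_iff hβ ha (neg_neg_of_pos (mul_pos hb hy)), stationaryPotential,
    ← sub_pos, ← sub_pos (b := _ - _)]
  refine iff_of_eq (congrArg (0 < ·) ?_)
  field_simp
  ring

lemma deriv_reducedFunctional_eq_zero_iff (hd : 1 ≤ d) (hβ : 0 < β) (ha : 0 < a) (hb : 0 < b)
    (hy : 0 < y) : deriv (reducedFunctional d β a b μ) y = 0 ↔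
      stationaryPotential d β a b (-(b * y)) = μ := by
  have hs : -(b * y) < 0 := neg_neg_of_pos (mul_pos hb hy)
  have hφ : stationaryPotential d β a b (-(b * y)) =
      a * idealDensity d β (-(b * y)) + (a - b) * y := by
    unfold stationaryPotential
    field_simp
    ring
  rw [(hasDerivAt_reducedFunctional hd hβ ha b μ y).deriv, add_eq_zero_iff_eq_neg, hφ]
  constructor
  · intro hσ
    have heq := mul_idealDensity_effectivePotential hβ ha (hσ.trans_lt hs)
    rw [hσ] at heq
    linarith
  · rintro rfl
    refine effectivePotential_eq_of_isConjugate hβ ha ?_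
    convert isConjugate_idealDensity hs
    field_simp
    ring

lemma deriv_reducedFunctional_neg_iff (hd : 1 ≤ d) (hβ : 0 < β) (ha : 0 < a) (hb : 0 < b)
    (hy : 0 < y) : deriv (reducedFunctional d β a b μ) y < 0 ↔
      μ < stationaryPotential d β a b (-(b * y)) := by
  rw [lt_iff_le_and_ne, ← not_lt, deriv_reducedFunctional_pos_iff hd hβ ha hb hy, not_lt,
    Ne, deriv_reducedFunctional_eq_zero_iff hd hβ ha hb hy, lt_iff_le_and_ne, ne_comm]

lemma strictMonoOn_reducedFunctional (hd : 1 ≤ d) (hβ : 0 < β) (ha : 0 < a) (hb : 0 < b)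
    (hy : 0 ≤ y) (h : ∀ w ∈ Ioo y z, stationaryPotential d β a b (-(b * w)) < μ) :
    StrictMonoOn (reducedFunctional d β a b μ) (Icc y z) := by
  refine strictMonoOn_of_deriv_pos (convex_Icc _ _)
    (continuous_reducedFunctional hd hβ ha b μ).continuousOn fun w hw => ?_
  rw [interior_Icc] at hw
  exact (deriv_reducedFunctional_pos_iff hd hβ ha hb (hy.trans_lt hw.1)).2 (h w hw)

lemma strictAntiOn_reducedFunctional (hd : 1 ≤ d) (hβ : 0 < β) (ha : 0 < a) (hb : 0 < b)
    (hy : 0 ≤ y) (h : ∀ w ∈ Ioo y z, μ < stationaryPotential d β a b (-(b * w))) :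
    StrictAntiOn (reducedFunctional d β a b μ) (Icc y z) := by
  refine strictAntiOn_of_deriv_neg (convex_Icc _ _)
    (continuous_reducedFunctional hd hβ ha b μ).continuousOn fun w hw => ?_
  rw [interior_Icc] at hw
  exact (deriv_reducedFunctional_neg_iff hd hβ ha hb (hy.trans_lt hw.1)).2 (h w hw)

lemma stationaryPotential_eq_of_isMaxOn (hd : 1 ≤ d) (hβ : 0 < β) (ha : 0 < a) (hb : 0 < b)
    (hκ : 0 ≤ κ) (hy : κ < y) (hmax : IsMaxOn (reducedFunctional d β a b μ) (Ici κ) y) :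
    stationaryPotential d β a b (-(b * y)) = μ :=
  (deriv_reducedFunctional_eq_zero_iff hd hβ ha hb (hκ.trans_lt hy)).1
    (hmax.isLocalMax (Ici_mem_nhds hy)).deriv_eq_zero

/-! ### The gain from long cycles -/

lemma hasDerivAt_longCycleGain (hd : 1 ≤ d) (hβ : 0 < β) (ha : 0 < a) (b y μ : ℝ) :
    HasDerivAt (longCycleGain d β a b y)
      ((effectivePotential d β a μ - effectivePotential d β a (μ - a * y)) / a) μ := by
  refine ((hasDerivAt_reducedFunctional_potential hd hβ ha b μ y).sub
    (hasDerivAt_reducedFunctional_potential hd hβ ha b μ 0)).congr_deriv ?_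
  rw [mul_zero, sub_zero]
  unfold optimalDensity
  field_simp
  ring

lemma monotone_longCycleGain (hd : 1 ≤ d) (hβ : 0 < β) (ha : 0 < a) (b : ℝ) (hy : 0 ≤ y) :
    Monotone (longCycleGain d β a b y) := by
  have hderiv := hasDerivAt_longCycleGain (d := d) hd hβ ha b y
  refine monotone_of_deriv_nonneg (fun μ => (hderiv μ).differentiableAt) fun μ => ?_
  rw [(hderiv μ).deriv]
  exact div_nonneg (sub_nonneg.2 (effectivePotential_mono hβ ha
    (sub_le_self _ (mul_nonneg ha.le hy)))) ha.le

lemma longCycleGain_lt_of_lt (hd : 1 ≤ d) (hβ : 0 < β) (ha : 0 < a) (hy : 0 < y)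
    (hμ : μ < ν) (h : effectivePotential d β a (μ - a * y) < 0) :
    longCycleGain d β a b y μ < longCycleGain d β a b y ν := by
  have hpos : 0 < (effectivePotential d β a μ - effectivePotential d β a (μ - a * y)) / a :=
    div_pos (sub_pos.2 (effectivePotential_lt_of_lt hβ ha (sub_lt_self _ (mul_pos ha hy)) h)) ha
  have hslope := (hasDerivAt_longCycleGain hd hβ ha b y μ).tendsto_slope.mono_left
    (nhdsGT_le_nhdsNE μ) |>.eventually (lt_mem_nhds hpos)
  obtain ⟨ξ, hξ, hμξ, hξν⟩ := (hslope.and (Ioo_mem_nhdsGT hμ)).exists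
  exact ((slope_pos_iff_of_le hμξ.le).1 hξ).trans_le
    (monotone_longCycleGain hd hβ ha b hy.le hξν.le)

/-! ### Peaks and the supercritical pressure -/

/-- A positive global maximiser of the reduced functional. -/
structure IsPeak (d : ℕ) (β a b μ y : ℝ) : Prop where
  pos : 0 < y
  isMaxOn : IsMaxOn (reducedFunctional d β a b μ) (Ici 0) y

namespace IsPeak

lemma neg_mul_neg (hb : 0 < b) (h : IsPeak d β a b μ y) : -(b * y) < 0 :=
  neg_neg_of_pos (mul_pos hb h.pos)

lemma stationaryPotential_eq (hd : 1 ≤ d) (hβ : 0 < β) (ha : 0 < a) (hb : 0 < b)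
    (h : IsPeak d β a b μ y) : stationaryPotential d β a b (-(b * y)) = μ :=
  stationaryPotential_eq_of_isMaxOn hd hβ ha hb le_rfl h.pos h.isMaxOn

lemma effectivePotential_eq (hd : 1 ≤ d) (hβ : 0 < β) (ha : 0 < a) (hb : 0 < b)
    (h : IsPeak d β a b μ y) : effectivePotential d β a (μ - a * y) = -(b * y) := by
  have hzero := (deriv_reducedFunctional_eq_zero_iff hd hβ ha hb h.pos).2
    (h.stationaryPotential_eq hd hβ ha hb)
  rw [(hasDerivAt_reducedFunctional hd hβ ha b μ y).deriv] at hzero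
  exact eq_neg_of_add_eq_zero_left hzero

lemma mul_idealDensity_eq (hd : 1 ≤ d) (hβ : 0 < β) (ha : 0 < a) (hb : 0 < b)
    (h : IsPeak d β a b μ y) : a * idealDensity d β (-(b * y)) = μ - (a - b) * y := by
  have heq := mul_idealDensity_effectivePotential (d := d) (ν := μ - a * y) hβ ha
    (h.effectivePotential_eq hd hβ ha hb ▸ h.neg_mul_neg hb)
  rw [h.effectivePotential_eq hd hβ ha hb] at heq
  linarith

lemma lt_stationaryPotential (hd : 1 ≤ d) (hβ : 0 < β) (ha : 0 < a) (hb : 0 < b)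
    (h : IsPeak d β a b μ y) (hs : s < -(b * y)) : μ < stationaryPotential d β a b s := by
  by_contra! hle
  have hyz : y < -s / b := by
    rw [lt_div_iff₀ hb]
    linarith
  refine (h.isMaxOn (h.pos.trans hyz).le).not_gt (strictMonoOn_reducedFunctional hd hβ ha hb
    h.pos.le (fun w hw => ?_) (left_mem_Icc.2 hyz.le) (right_mem_Icc.2 hyz.le) hyz)
  refine stationaryPotential_lt_of_mem_Ioo hβ ha (h.neg_mul_neg hb) hle
    (h.stationaryPotential_eq hd hβ ha hb).le ⟨?_, ?_⟩
  · have := (lt_div_iff₀ hb).1 hw.2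
    linarith
  · exact neg_lt_neg (mul_lt_mul_of_pos_left hw.1 hb)

lemma exists_stationaryPotential_lt (hd : 1 ≤ d) (hβ : 0 < β) (ha : 0 < a) (hb : 0 < b)
    (h : IsPeak d β a b μ y) : ∃ t < 0, stationaryPotential d β a b t < μ := by
  by_contra! hle
  refine (h.isMaxOn self_mem_Ici).not_gt (strictAntiOn_reducedFunctional hd hβ ha hb le_rfl
    (fun w hw => ?_) (left_mem_Icc.2 h.pos.le) (right_mem_Icc.2 h.pos.le) h.pos)
  have hw0 : -(b * w) < 0 := neg_neg_of_pos (mul_pos hb hw.1)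
  have hlt : -(b * y) < -(b * w) := neg_lt_neg (mul_lt_mul_of_pos_left hw.2 hb)
  by_contra! hw'
  obtain ⟨r, hr⟩ := exists_between hlt
  exact (hle r (hr.2.trans hw0)).not_gt (stationaryPotential_lt_of_mem_Ioo hβ ha hw0
    (h.stationaryPotential_eq hd hβ ha hb).le hw' hr)

lemma le_of_le (hd : 1 ≤ d) (hβ : 0 < β) (ha : 0 < a) (hb : 0 < b) (h : IsPeak d β a b μ y)
    (h' : IsPeak d β a b ν z) (hμ : μ ≤ ν) : y ≤ z := by
  by_contra! hlt
  have hν := h'.lt_stationaryPotential hd hβ ha hb (neg_lt_neg (mul_lt_mul_of_pos_left hlt hb))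
  rw [h.stationaryPotential_eq hd hβ ha hb] at hν
  linarith

lemma unique (hd : 1 ≤ d) (hβ : 0 < β) (ha : 0 < a) (hb : 0 < b) (h : IsPeak d β a b μ y)
    (h' : IsPeak d β a b μ z) : y = z :=
  le_antisymm (h.le_of_le hd hβ ha hb h' le_rfl) (h'.le_of_le hd hβ ha hb h le_rfl)

lemma longCycleGain_pos (hd : 1 ≤ d) (hβ : 0 < β) (ha : 0 < a) (hb : 0 < b)
    (h : IsPeak d β a b μ y) (hμ : μ < ν) : 0 < longCycleGain d β a b y ν :=
  (sub_nonneg.2 (h.isMaxOn self_mem_Ici)).trans_lt (longCycleGain_lt_of_lt hd hβ ha h.pos hμ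
    (h.effectivePotential_eq hd hβ ha hb ▸ h.neg_mul_neg hb))

end IsPeak

/-- The function of `s` whose supremum is the supercritical pressure. -/
noncomputable def superFunctional (d : ℕ) (β a b μ s : ℝ) : ℝ :=
  (μ - s) ^ 2 / (2 * a) - s ^ 2 / (2 * b) + idealPressure d β s

lemma superFunctional_le (hd : 1 ≤ d) (hβ : 0 < β) (hb : 0 < b) (hab : b < a) (hs : s < 0) :
    superFunctional d β a b μ s ≤
      reducedFunctional d β a b μ ((μ - a * idealDensity d β s) / (a - b)) := by
  have ha : 0 < a := hb.trans hab
  have hba : 0 < a - b := sub_pos.2 hab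
  have hle := pressureFunctional_le hd hβ ha b μ ((μ - a * idealDensity d β s) / (a - b))
    (idealDensity_pos (d := d) hβ hs).le
  rw [pressureFunctional, (isConjugate_idealDensity hs).freeEnergy_eq hd hβ] at hle
  set x := idealDensity d β s
  set y := (μ - a * x) / (a - b)
  have hnonneg : 0 ≤ a / 2 * (x - optimalDensity d β a (μ - a * y)) ^ 2 := by positivity
  have hsq : μ * (x + y) - a / 2 * (x + y) ^ 2 + b / 2 * y ^ 2 - (s * x - idealPressure d β s) -
      superFunctional d β a b μ s = (b * y + s) ^ 2 * (a - b) / (2 * a * b) := by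
    have hμ : μ = a * x + (a - b) * y := by
      simp only [y]
      field_simp
      ring
    rw [hμ, superFunctional]
    field_simp
    ring
  have hsq_nonneg : 0 ≤ (b * y + s) ^ 2 * (a - b) / (2 * a * b) := by positivity
  linarith

lemma superFunctional_le_of_isMaxOn (hd : 1 ≤ d) (hβ : 0 < β) (hb : 0 < b) (hab : b < a)
    (hmax : IsMaxOn (reducedFunctional d β a b μ) (Ici 0) y) (hs : s < 0)
    (hsμ : a * idealDensity d β s ≤ μ) :
    superFunctional d β a b μ s ≤ reducedFunctional d β a b μ y :=
  (superFunctional_le hd hβ hb hab hs).trans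
    (hmax (div_nonneg (sub_nonneg.2 hsμ) (sub_pos.2 hab).le))

lemma IsPeak.superFunctional_eq (hd : 1 ≤ d) (hβ : 0 < β) (ha : 0 < a) (hb : 0 < b)
    (h : IsPeak d β a b μ y) :
    superFunctional d β a b μ (-(b * y)) = reducedFunctional d β a b μ y := by
  unfold reducedFunctional superFunctional
  rw [pSub_eq hd hβ ha, h.effectivePotential_eq hd hβ ha hb]
  field_simp
  ring

lemma pSup_eq_sSup (hd : 1 ≤ d) (hβ : 0 < β) : pSup d β a b μ =
    sSup (superFunctional d β a b μ '' {s | s < 0 ∧ a * idealDensity d β s ≤ μ}) := by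
  have hset : {s : ℝ | s < 0 ∧ a * deriv (idealPressure d β) s ≤ μ} =
      {s | s < 0 ∧ a * idealDensity d β s ≤ μ} :=
    Set.ext fun s => and_congr_right fun hs => by rw [deriv_idealPressure hd hβ hs]
  rw [pSup, hset]
  rfl

lemma IsPeak.pSup_eq (hd : 1 ≤ d) (hβ : 0 < β) (hb : 0 < b) (hab : b < a)
    (h : IsPeak d β a b μ y) : pSup d β a b μ = reducedFunctional d β a b μ y := by
  have ha : 0 < a := hb.trans hab
  rw [pSup_eq_sSup hd hβ]
  refine IsGreatest.csSup_eq ⟨⟨-(b * y), ⟨h.neg_mul_neg hb, ?_⟩, h.superFunctional_eq hd hβ ha hb⟩,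
    forall_mem_image.2 fun s hs => superFunctional_le_of_isMaxOn hd hβ hb hab h.isMaxOn hs.1 hs.2⟩
  rw [h.mul_idealDensity_eq hd hβ ha hb]
  exact sub_le_self _ (mul_nonneg (sub_pos.2 hab).le h.pos.le)

end Stationary

/-! ### The transition potential without a restriction on the long cycles -/

/-- `m` separates the potentials without and with long cycles when `κ = 0`. -/
structure IsThreshold (d : ℕ) (β a b m : ℝ) : Prop where
  isMaxOn_zero : ∀ μ ≤ m, IsMaxOn (reducedFunctional d β a b μ) (Ici 0) 0
  not_isPeak : ∀ μ < m, ∀ y, ¬IsPeak d β a b μ y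
  exists_isPeak : ∀ μ > m, ∃ y, IsPeak d β a b μ y

section Threshold

variable {d : ℕ} {β a b m μ μ₀ s : ℝ}

lemma stationaryPotential_nonneg (hβ : 0 < β) (hb : 0 < b) (hab : b < a) (hs : s < 0) :
    0 ≤ stationaryPotential d β a b s :=
  sub_nonneg.2 ((mul_nonpos_of_nonneg_of_nonpos (div_nonneg (sub_pos.2 hab).le hb.le) hs.le).trans
    (mul_nonneg (hb.trans hab).le (idealDensity_pos hβ hs).le))

lemma muT_eq_sInf (hd : 1 ≤ d) (hβ : 0 < β) :
    muT d β a b = sInf (stationaryPotential d β a b '' Iio 0) :=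
  congrArg sInf (image_congr fun s hs => by rw [deriv_idealPressure hd hβ hs, stationaryPotential])

lemma muT_le (hd : 1 ≤ d) (hβ : 0 < β) (hb : 0 < b) (hab : b < a) (hs : s < 0) :
    muT d β a b ≤ stationaryPotential d β a b s :=
  (muT_eq_sInf hd hβ).trans_le <| csInf_le
    ⟨0, forall_mem_image.2 fun _ => stationaryPotential_nonneg hβ hb hab⟩ ⟨s, hs, rfl⟩

lemma exists_longCycleGain_pos_of_density_le (hd : 1 ≤ d) (hβ : 0 < β) (ha : 0 < a) (hb : 0 < b)
    (h : ∀ s < 0, a * idealDensity d β s ≤ μ₀) (hμ : μ₀ < μ) :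
    ∃ y > 0, 0 < longCycleGain d β a b y μ := by
  have hσ : ∀ ν ≥ μ₀, effectivePotential d β a ν = 0 := fun ν hν =>
    effectivePotential_eq_of_isConjugate hβ ha <| isConjugate_zero fun s hs => by
      rw [sub_zero, le_div_iff₀' ha]
      exact (h s hs).trans hν
  have hy : 0 < (μ - μ₀) / a := div_pos (sub_pos.2 hμ) ha
  have harg : μ - a * ((μ - μ₀) / a) = μ₀ := by
    field_simp
    ring
  have hgain : longCycleGain d β a b ((μ - μ₀) / a) μ = b / 2 * ((μ - μ₀) / a) ^ 2 := by
    rw [longCycleGain, reducedFunctional_zero, reducedFunctional, harg, pSub_eq hd hβ ha,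
      pSub_eq hd hβ ha, hσ μ hμ.le, hσ μ₀ le_rfl]
    field_simp
    ring
  exact ⟨_, hy, hgain ▸ by positivity⟩

lemma exists_longCycleGain_pos (hd : 1 ≤ d) (hβ : 0 < β) (hb : 0 < b) (hab : b < a) :
    ∃ μ, ∃ y > 0, 0 < longCycleGain d β a b y μ := by
  have ha : 0 < a := hb.trans hab
  have hs : (-1 : ℝ) < 0 := by norm_num
  have hρ := idealDensity_pos (d := d) hβ hs
  have hp := idealPressure_nonneg (d := d) hβ 0
  obtain ⟨μ, hμ⟩ : ∃ μ, μ / a = 1 / (2 * b) + idealPressure d β 0 + idealDensity d β (-1) :=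
    ⟨_, mul_div_cancel_left₀ _ ha.ne'⟩
  have hμρ : a * idealDensity d β (-1) < μ := by
    rw [← lt_div_iff₀' ha, hμ]
    linarith [show 0 < 1 / (2 * b) by positivity]
  refine ⟨μ, _, div_pos (sub_pos.2 hμρ) (sub_pos.2 hab),
    sub_pos.2 (lt_of_lt_of_le ?_ (superFunctional_le hd hβ hb hab hs))⟩
  rw [reducedFunctional_zero]
  refine (pSub_le hd hβ ha μ le_rfl).trans_lt ?_
  have hdiff : superFunctional d β a b μ (-1) - ((μ - 0) ^ 2 / (2 * a) + idealPressure d β 0) =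
      μ / a - 1 / (2 * b) + 1 / (2 * a) + idealPressure d β (-1) - idealPressure d β 0 := by
    unfold superFunctional
    field_simp
    ring
  linarith [show 0 < 1 / (2 * a) by positivity, idealPressure_nonneg (d := d) hβ (-1)]

lemma exists_isPeak_of_longCycleGain_pos (hd : 1 ≤ d) (hβ : 0 < β) (ha : 0 < a) (hab : b < a)
    (h : ∃ y > 0, 0 < longCycleGain d β a b y μ) : ∃ y, IsPeak d β a b μ y := by
  obtain ⟨y, hy, hlt⟩ := h
  obtain ⟨z, hz, hmax⟩ := exists_isMaxOn (d := d) hd hβ ha hab isClosed_Ici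
    (nonempty_Ici (a := (0 : ℝ))) subset_rfl μ
  refine ⟨z, lt_of_le_of_ne hz ?_, hmax⟩
  rintro rfl
  exact (hmax (mem_Ici.2 hy.le)).not_gt (sub_pos.1 hlt)

lemma muT_le_of_isPeak (hd : 1 ≤ d) (hβ : 0 < β) (hb : 0 < b) (hab : b < a) {y : ℝ}
    (h : IsPeak d β a b μ y) : muT d β a b ≤ μ :=
  h.stationaryPotential_eq hd hβ (hb.trans hab) hb ▸ muT_le hd hβ hb hab (h.neg_mul_neg hb)

lemma exists_isThreshold (hd : 1 ≤ d) (hβ : 0 < β) (hb : 0 < b) (hab : b < a) :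
    ∃ m, IsThreshold d β a b m := by
  have ha : 0 < a := hb.trans hab
  set U := {μ | ∃ y > 0, 0 < longCycleGain d β a b y μ}
  have hne : U.Nonempty := exists_longCycleGain_pos hd hβ hb hab
  have hbdd : BddBelow U := ⟨muT d β a b, fun μ hμ =>
    muT_le_of_isPeak hd hβ hb hab (exists_isPeak_of_longCycleGain_pos hd hβ ha hab hμ).choose_spec⟩
  refine ⟨sInf U, fun μ hμ y hy => ?_, fun μ hμ y hpeak => ?_, fun μ hμ => ?_⟩
  · by_contra hlt
    replace hlt : reducedFunctional d β a b μ 0 < reducedFunctional d β a b μ y := not_le.1 hlt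
    have hy0 : 0 < y := lt_of_le_of_ne hy (by rintro rfl; exact lt_irrefl _ hlt)
    have hcont := continuous_reducedFunctional_potential (d := d) hd hβ ha b
    obtain ⟨ν, hν, hνμ⟩ := ((((hcont 0).continuousAt.eventually_lt (hcont y).continuousAt
      hlt).filter_mono nhdsWithin_le_nhds).and (self_mem_nhdsWithin (s := Iio μ))).exists
    exact ((csInf_le hbdd ⟨y, hy0, sub_pos.2 hν⟩).trans_lt hνμ).not_ge hμ
  · obtain ⟨ν, hμν, hνU⟩ := exists_between hμ
    exact hνU.not_ge (csInf_le hbdd ⟨y, hpeak.pos, hpeak.longCycleGain_pos hd hβ ha hb hμν⟩)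
  · obtain ⟨ν, ⟨y, hy, hgain⟩, hνμ⟩ := exists_lt_of_csInf_lt hne hμ
    exact exists_isPeak_of_longCycleGain_pos hd hβ ha hab
      ⟨y, hy, hgain.trans_le (monotone_longCycleGain hd hβ ha b hy.le hνμ.le)⟩

namespace IsThreshold

lemma muT_le (hd : 1 ≤ d) (hβ : 0 < β) (hb : 0 < b) (hab : b < a) (h : IsThreshold d β a b m) :
    muT d β a b ≤ m :=
  le_of_forall_gt_imp_ge_of_dense fun μ hμ =>
    muT_le_of_isPeak hd hβ hb hab (h.exists_isPeak μ hμ).choose_spec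

lemma le_of_density_le (hd : 1 ≤ d) (hβ : 0 < β) (ha : 0 < a) (hb : 0 < b)
    (h : IsThreshold d β a b m) (hμ : ∀ s < 0, a * idealDensity d β s ≤ μ) : m ≤ μ := by
  by_contra! hlt
  obtain ⟨y, hy, hgain⟩ := exists_longCycleGain_pos_of_density_le (b := b) hd hβ ha hb hμ hlt
  exact (h.isMaxOn_zero m le_rfl (mem_Ici.2 hy.le)).not_gt (sub_pos.1 hgain)

lemma le_muC (hd : 1 ≤ d) (hβ : 0 < β) (ha : 0 < a) (hb : 0 < b) (h : IsThreshold d β a b m) :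
    (m : EReal) ≤ muC d β a := by
  have hbot : criticalDensity d β ≠ ⊥ := by
    unfold criticalDensity
    split_ifs
    · exact EReal.coe_ne_bot _
    · exact top_ne_bot
  unfold muC
  rcases eq_or_ne (criticalDensity d β) ⊤ with htop | htop
  · rw [htop, EReal.coe_mul_top_of_pos ha]
    exact le_top
  · obtain ⟨ρ, hρ⟩ : ∃ ρ : ℝ, criticalDensity d β = ρ := ⟨_, (EReal.coe_toReal htop hbot).symm⟩
    rw [hρ, ← EReal.coe_mul, EReal.coe_le_coe_iff]
    exact h.le_of_density_le hd hβ ha hb fun s hs =>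
      mul_le_mul_of_nonneg_left ((criticalDensity_le_iff hβ ρ).1 hρ.le s hs) ha.le

lemma mul_idealDensity_le (hd : 1 ≤ d) (hβ : 0 < β) (hb : 0 < b) (hab : b < a)
    (h : IsThreshold d β a b m) (hμ : m < μ) {y : ℝ} (hy : IsPeak d β a b μ y) :
    a * idealDensity d β (-(b * y)) ≤ m := by
  have ha : 0 < a := hb.trans hab
  refine le_of_forall_gt_imp_ge_of_dense fun ν hν => ?_
  obtain ⟨z, hz⟩ := h.exists_isPeak (min ν μ) (lt_min hν hμ)
  have hzy : z ≤ y := hz.le_of_le hd hβ ha hb hy (min_le_right _ _)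
  calc a * idealDensity d β (-(b * y))
      ≤ a * idealDensity d β (-(b * z)) :=
        mul_le_mul_of_nonneg_left ((strictMonoOn_idealDensity hβ).monotoneOn (hy.neg_mul_neg hb)
          (hz.neg_mul_neg hb) (neg_le_neg (mul_le_mul_of_nonneg_left hzy hb.le))) ha.le
    _ = min ν μ - (a - b) * z := hz.mul_idealDensity_eq hd hβ ha hb
    _ ≤ min ν μ := sub_le_self _ (mul_nonneg (sub_pos.2 hab).le hz.pos.le)
    _ ≤ ν := min_le_left _ _

lemma exists_lt_superFunctional (hd : 1 ≤ d) (hβ : 0 < β) (hb : 0 < b) (hab : b < a)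
    (h : IsThreshold d β a b m) {w : ℝ} (hw : w < reducedFunctional d β a b m 0) :
    ∃ s < 0, a * idealDensity d β s ≤ m ∧ w < superFunctional d β a b m s := by
  have ha : 0 < a := hb.trans hab
  obtain ⟨Y, hY⟩ := h.exists_isPeak (m + 1) (lt_add_one m)
  -- For `s = -b y` with `y ≤ Y`, lowering `μ` to `m` costs at most the term subtracted here.
  have hcont : Continuous fun μ => reducedFunctional d β a b μ 0 -
      (μ - m) * (μ + m + 2 * b * Y) / (2 * a) := by
    have := continuous_reducedFunctional_potential (d := d) hd hβ ha b 0
    fun_prop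
  have hev : ∀ᶠ μ in 𝓝[>] m, w < reducedFunctional d β a b μ 0 -
      (μ - m) * (μ + m + 2 * b * Y) / (2 * a) :=
    ((hcont.tendsto m).mono_left nhdsWithin_le_nhds).eventually (lt_mem_nhds (by simpa using hw))
  obtain ⟨μ, hμ, hmμ, hμ1⟩ := (hev.and (Ioo_mem_nhdsGT (lt_add_one m))).exists
  obtain ⟨y, hy⟩ := h.exists_isPeak μ hmμ
  refine ⟨-(b * y), hy.neg_mul_neg hb, h.mul_idealDensity_le hd hβ hb hab hmμ hy, ?_⟩
  have hmax : reducedFunctional d β a b μ 0 ≤ superFunctional d β a b μ (-(b * y)) :=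
    hy.superFunctional_eq hd hβ ha hb ▸ hy.isMaxOn self_mem_Ici
  have hdiff : superFunctional d β a b μ (-(b * y)) - superFunctional d β a b m (-(b * y)) =
      (μ - m) * (μ + m + 2 * b * y) / (2 * a) := by
    unfold superFunctional
    field_simp
    ring
  have hyY : y ≤ Y := hy.le_of_le hd hβ ha hb hY hμ1.le
  have hcost : (μ - m) * (μ + m + 2 * b * y) / (2 * a) ≤
      (μ - m) * (μ + m + 2 * b * Y) / (2 * a) := by
    have : 0 ≤ μ - m := (sub_pos.2 hmμ).le
    gcongr
  linarith

lemma pSup_eq (hd : 1 ≤ d) (hβ : 0 < β) (hb : 0 < b) (hab : b < a) (h : IsThreshold d β a b m) :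
    pSup d β a b m = reducedFunctional d β a b m 0 := by
  rw [pSup_eq_sSup hd hβ]
  have hexists : ∀ w < reducedFunctional d β a b m 0,
      ∃ z ∈ superFunctional d β a b m '' {s | s < 0 ∧ a * idealDensity d β s ≤ m}, w < z :=
    fun w hw => by
      obtain ⟨s, hs, hsm, hlt⟩ := h.exists_lt_superFunctional hd hβ hb hab hw
      exact ⟨_, ⟨s, ⟨hs, hsm⟩, rfl⟩, hlt⟩
  obtain ⟨z, hz, -⟩ := hexists _ (sub_one_lt _)
  exact csSup_eq_of_forall_le_of_forall_lt_exists_gt ⟨z, hz⟩ (forall_mem_image.2 fun s hs =>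
    superFunctional_le_of_isMaxOn hd hβ hb hab (h.isMaxOn_zero m le_rfl) hs.1 hs.2) hexists

end IsThreshold

end Threshold

/-! ### The potential `μ_r` -/

section MuR

variable {d : ℕ} {β a b κ μ s t y x : ℝ}

lemma tendsto_stationaryPotential_atBot (hβ : 0 < β) (hb : 0 < b) (hab : b < a) :
    Tendsto (stationaryPotential d β a b) atBot atTop := by
  have hc : 0 < (a - b) / b := div_pos (sub_pos.2 hab) hb
  refine tendsto_atTop_mono' _ ?_ ((tendsto_id.const_mul_atBot_of_neg (neg_neg_of_pos hc)))
  filter_upwards [eventually_lt_atBot 0] with s hs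
  have := mul_pos (hb.trans hab) (idealDensity_pos (d := d) hβ hs)
  simp only [stationaryPotential, id]
  linarith

lemma exists_isMinOn_stationaryPotential (hβ : 0 < β) (hb : 0 < b) (hab : b < a) (ht : t < 0) :
    ∃ s ∈ Iic t, IsMinOn (stationaryPotential d β a b) (Iic t) s := by
  refine ((continuousOn_stationaryPotential hβ).mono (Iic_subset_Iio.2 ht)).exists_isMinOn'
    isClosed_Iic self_mem_Iic ?_
  rw [cocompact_eq_atBot_atTop, inf_sup_right, (disjoint_atTop_principal_Iic t).eq_bot, sup_bot_eq]
  exact ((tendsto_stationaryPotential_atBot hβ hb hab).eventually_ge_atTop _).filter_mono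
    inf_le_left

lemma exists_stationaryPotential_eq (hβ : 0 < β) (hb : 0 < b) (hab : b < a) (hs : s < 0)
    (h : stationaryPotential d β a b s ≤ μ) : ∃ t ≤ s, stationaryPotential d β a b t = μ := by
  have hlarge := (tendsto_stationaryPotential_atBot (d := d) hβ hb hab).eventually_ge_atTop μ
  obtain ⟨r, hr, hrs⟩ := (hlarge.and (eventually_le_atBot s)).exists
  exact isPreconnected_Iic.intermediate_value self_mem_Iic hrs
    ((continuousOn_stationaryPotential hβ).mono (Iic_subset_Iio.2 hs)) ⟨h, hr⟩

lemma mul_idealDensity_le_muT (hd : 1 ≤ d) (hβ : 0 < β) (hb : 0 < b) (hab : b < a)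
    (h : ∀ s < 0, muT d β a b < stationaryPotential d β a b s) (ht : t < 0) :
    a * idealDensity d β t ≤ muT d β a b := by
  have ha : 0 < a := hb.trans hab
  obtain ⟨s, hst, hmin⟩ := exists_isMinOn_stationaryPotential (d := d) hβ hb hab ht
  refine le_of_forall_gt_imp_ge_of_dense fun μ hμ => ?_
  have hlt : muT d β a b < min (stationaryPotential d β a b s) μ :=
    lt_min (h s (hst.trans_lt ht)) hμ
  rw [muT_eq_sInf hd hβ] at hlt
  obtain ⟨_, ⟨r, hr, rfl⟩, hrlt⟩ := exists_lt_of_csInf_lt (nonempty_Iio.image _) hlt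
  have htr : t < r := by
    by_contra! hrt
    exact (hmin hrt).not_gt (hrlt.trans_le (min_le_left _ _))
  calc a * idealDensity d β t
      ≤ a * idealDensity d β r :=
        mul_le_mul_of_nonneg_left (strictMonoOn_idealDensity hβ ht hr htr).le ha.le
    _ ≤ stationaryPotential d β a b r := le_sub_self_iff _ |>.2 <|
        mul_nonpos_of_nonneg_of_nonpos (div_nonneg (sub_pos.2 hab).le hb.le) (mem_Iio.1 hr).le
    _ ≤ μ := (hrlt.trans_le (min_le_right _ _)).le

lemma xTwo_eq_sInf (hd : 1 ≤ d) (hβ : 0 < β) :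
    xTwo d β a b μ = sInf {x | IsConjugate d β x (-(b / (a - b)) * (μ - a * x))} := by
  refine congrArg sInf (Set.ext fun x => ⟨fun h => (sBeta_eq_iff hd hβ h.1).1 h.2, fun h => ?_⟩)
  have hx : 0 < x := h.pos hβ
  exact ⟨hx, (sBeta_eq_iff hd hβ hx).2 h⟩

lemma isConjugate_of_stationaryPotential_eq (hb : 0 < b) (hab : b < a) (hs : s < 0)
    (h : stationaryPotential d β a b s = μ) :
    IsConjugate d β (idealDensity d β s) (-(b / (a - b)) * (μ - a * idealDensity d β s)) := by
  have hab' : a - b ≠ 0 := (sub_pos.2 hab).ne'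
  convert isConjugate_idealDensity hs using 1
  rw [← h, stationaryPotential]
  field_simp
  ring

lemma exists_isConjugate_of_muT_le (hd : 1 ≤ d) (hβ : 0 < β) (hb : 0 < b) (hab : b < a)
    (hμ : muT d β a b ≤ μ) : ∃ x, IsConjugate d β x (-(b / (a - b)) * (μ - a * x)) := by
  have ha : 0 < a := hb.trans hab
  by_cases! h : ∃ s < 0, stationaryPotential d β a b s ≤ μ
  · obtain ⟨s, hs, hle⟩ := h
    obtain ⟨t, hts, ht⟩ := exists_stationaryPotential_eq hβ hb hab hs hle
    exact ⟨_, isConjugate_of_stationaryPotential_eq hb hab (hts.trans_lt hs) ht⟩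
  · have hle : ∀ t < 0, a * idealDensity d β t ≤ μ := fun t ht =>
      (mul_idealDensity_le_muT hd hβ hb hab (fun s hs => hμ.trans_lt (h s hs)) ht).trans hμ
    refine ⟨μ / a, ?_⟩
    rw [mul_div_cancel₀ _ ha.ne', sub_self, mul_zero]
    exact isConjugate_zero fun t ht => (le_div_iff₀' ha).2 (hle t ht)

lemma xTwo_le (hd : 1 ≤ d) (hβ : 0 < β) (hb : 0 < b) (hab : b < a) (hs : s < 0)
    (h : stationaryPotential d β a b s = μ) : xTwo d β a b μ ≤ idealDensity d β s :=
  (xTwo_eq_sInf hd hβ).trans_le <| csInf_le ⟨0, fun _ hx => (IsConjugate.pos hβ hx).le⟩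
    (isConjugate_of_stationaryPotential_eq hb hab hs h)

lemma le_xTwo (hd : 1 ≤ d) (hβ : 0 < β) (hb : 0 < b) (hab : b < a) (hμ : muT d β a b ≤ μ)
    (hs : s ≤ 0) (h : ∀ t < s, μ < stationaryPotential d β a b t) :
    (μ + (a - b) / b * s) / a ≤ xTwo d β a b μ := by
  have ha : 0 < a := hb.trans hab
  have hba : 0 < a - b := sub_pos.2 hab
  rw [xTwo_eq_sInf hd hβ]
  refine le_csInf (exists_isConjugate_of_muT_le hd hβ hb hab hμ) fun x hx => ?_
  obtain ⟨t, ht⟩ : ∃ t, t = -(b / (a - b)) * (μ - a * x) := ⟨_, rfl⟩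
  have hax : a * x = μ + (a - b) / b * t := by
    rw [ht]
    field_simp
    ring
  have hst : s ≤ t := by
    by_contra! hlt
    have hφ : stationaryPotential d β a b t = μ := by
      rw [stationaryPotential, (ht ▸ hx : IsConjugate d β x t).density_eq (hlt.trans_le hs), hax]
      ring
    exact (h t hlt).ne' hφ
  rw [div_le_iff₀' ha, hax]
  gcongr

lemma mem_muR_set_iff (hd : 1 ≤ d) (hβ : 0 < β) (hb : 0 < b) (hab : b < a) (hκ : 0 < κ) :
    (muT d β a b ≤ μ ∧ xTwo d β a b μ ≤ 1 / a * (μ - κ * (a - b))) ↔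
      ∃ s ≤ -(b * κ), stationaryPotential d β a b s ≤ μ := by
  have ha : 0 < a := hb.trans hab
  have : 0 < a - b := sub_pos.2 hab
  have hbκ : -(b * κ) < 0 := neg_neg_of_pos (mul_pos hb hκ)
  have hx : 1 / a * (μ - κ * (a - b)) = (μ + (a - b) / b * -(b * κ)) / a := by
    field_simp
    ring
  rw [hx]
  constructor
  · rintro ⟨hμ, hle⟩
    by_contra! h
    obtain ⟨u, hu, hsub⟩ := exists_Ico_subset_of_mem_nhds
      (((continuousOn_stationaryPotential hβ).continuousAt (Iio_mem_nhds hbκ)).eventually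
        (lt_mem_nhds (h _ le_rfl))) ⟨0, hbκ⟩
    have hlow := le_xTwo hd hβ hb hab hμ (min_le_right u 0) fun t ht =>
      (le_or_gt t (-(b * κ))).elim (h t) fun hlt => hsub ⟨hlt.le, ht.trans_le (min_le_left _ _)⟩
    refine (hlow.trans hle).not_gt ?_
    have := lt_min hu hbκ
    gcongr
  · rintro ⟨s, hs, hle⟩
    have hs0 : s < 0 := hs.trans_lt hbκ
    obtain ⟨t, hts, ht⟩ := exists_stationaryPotential_eq hβ hb hab hs0 hle
    refine ⟨(muT_le hd hβ hb hab hs0).trans hle,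
      (xTwo_le hd hβ hb hab (hts.trans_lt hs0) ht).trans ?_⟩
    have hρ : a * idealDensity d β t = μ + (a - b) / b * t := by
      rw [← ht, stationaryPotential]
      ring
    rw [le_div_iff₀' ha, hρ]
    have := hts.trans hs
    gcongr

lemma isLeast_muR (hd : 1 ≤ d) (hβ : 0 < β) (hb : 0 < b) (hab : b < a) (hκ : 0 < κ) :
    IsLeast (stationaryPotential d β a b '' Iic (-(b * κ))) (muR d β a b κ) := by
  obtain ⟨s, hs, hmin⟩ := exists_isMinOn_stationaryPotential (d := d) hβ hb hab
    (neg_neg_of_pos (mul_pos hb hκ))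
  have heq : muR d β a b κ = stationaryPotential d β a b s := by
    simp only [muR, mem_muR_set_iff hd hβ hb hab hκ]
    exact IsLeast.csInf_eq ⟨⟨s, hs, le_rfl⟩, fun μ ⟨t, ht, hle⟩ => (hmin ht).trans hle⟩
  exact heq ▸ ⟨mem_image_of_mem _ hs, forall_mem_image.2 hmin⟩

lemma muR_le_stationaryPotential (hd : 1 ≤ d) (hβ : 0 < β) (hb : 0 < b) (hab : b < a) (hκ : 0 < κ)
    (hy : κ ≤ y) : muR d β a b κ ≤ stationaryPotential d β a b (-(b * y)) :=
  (isLeast_muR hd hβ hb hab hκ).2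
    ⟨_, neg_le_neg (mul_le_mul_of_nonneg_left hy hb.le), rfl⟩

lemma muR_le_of_isMaxOn (hd : 1 ≤ d) (hβ : 0 < β) (hb : 0 < b) (hab : b < a) (hκ : 0 < κ)
    (hy : κ < y) (h : IsMaxOn (reducedFunctional d β a b μ) (Ici κ) y) : muR d β a b κ ≤ μ :=
  stationaryPotential_eq_of_isMaxOn hd hβ (hb.trans hab) hb hκ.le hy h ▸
    muR_le_stationaryPotential hd hβ hb hab hκ hy.le

namespace IsPeak

lemma muR_le_iff (hd : 1 ≤ d) (hβ : 0 < β) (hb : 0 < b) (hab : b < a) (hκ : 0 < κ)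
    (h : IsPeak d β a b μ y) : muR d β a b κ ≤ μ ↔ κ ≤ y := by
  have ha : 0 < a := hb.trans hab
  refine ⟨fun hμ => ?_, fun hy => h.stationaryPotential_eq hd hβ ha hb ▸
    muR_le_stationaryPotential hd hβ hb hab hκ hy⟩
  obtain ⟨s, hs, hsμ⟩ := (isLeast_muR (d := d) hd hβ hb hab hκ).1
  by_contra! hlt
  exact (h.lt_stationaryPotential hd hβ ha hb
    ((mem_Iic.1 hs).trans_lt (neg_lt_neg (mul_lt_mul_of_pos_left hlt hb)))).not_ge (hsμ.trans_le hμ)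

lemma eq_of_muR_eq (hd : 1 ≤ d) (hβ : 0 < β) (hb : 0 < b) (hab : b < a) (hκ : 0 < κ)
    (h : IsPeak d β a b (muR d β a b κ) y) : y = κ := by
  have ha : 0 < a := hb.trans hab
  refine le_antisymm ?_ ((h.muR_le_iff hd hβ hb hab hκ).1 le_rfl)
  by_contra! hlt
  obtain ⟨t, ht, htlt⟩ := h.exists_stationaryPotential_lt hd hβ ha hb
  have hκt : -(b * κ) < t := by
    by_contra! hle
    exact ((isLeast_muR hd hβ hb hab hκ).2 ⟨t, hle, rfl⟩).not_gt htlt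
  exact (muR_le_stationaryPotential hd hβ hb hab hκ le_rfl).not_gt
    (stationaryPotential_lt_of_mem_Ioo hβ ha ht (h.stationaryPotential_eq hd hβ ha hb).le htlt.le
      ⟨neg_lt_neg (mul_lt_mul_of_pos_left hlt hb), hκt⟩)

end IsPeak

end MuR

/-! ### The transition potential for given `κ` -/

section Transition

variable {d : ℕ} {β a b κ m μ ν y : ℝ}

lemma effectivePotential_neg_of_longCycleGain_nonpos (hd : 1 ≤ d) (hβ : 0 < β) (ha : 0 < a)
    (hb : 0 < b) (hy : 0 < y) (h : longCycleGain d β a b y μ ≤ 0) :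
    effectivePotential d β a (μ - a * y) < 0 := by
  refine (effectivePotential_nonpos hβ).lt_of_ne fun hσ => h.not_gt ?_
  have hle := pSub_le (d := d) hd hβ ha μ le_rfl
  rw [longCycleGain, reducedFunctional_zero, reducedFunctional, pSub_eq hd hβ ha (μ - a * y), hσ]
  have hdiff : (μ - a * y - 0) ^ 2 / (2 * a) + μ * y - (a - b) / 2 * y ^ 2 -
      (μ - 0) ^ 2 / (2 * a) = b / 2 * y ^ 2 := by
    field_simp
    ring
  linarith [show 0 < b / 2 * y ^ 2 by positivity]

lemma longCycleGain_lt_of_nonpos (hd : 1 ≤ d) (hβ : 0 < β) (ha : 0 < a) (hb : 0 < b) (hy : 0 < y)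
    (hμ : μ < ν) (h : longCycleGain d β a b y ν ≤ 0) :
    longCycleGain d β a b y μ < longCycleGain d β a b y ν :=
  longCycleGain_lt_of_lt hd hβ ha hy hμ <|
    (effectivePotential_mono hβ ha (sub_le_sub_right hμ.le _)).trans_lt
      (effectivePotential_neg_of_longCycleGain_nonpos hd hβ ha hb hy h)

namespace IsThreshold

lemma longCycleGain_pos (hd : 1 ≤ d) (hβ : 0 < β) (ha : 0 < a) (hb : 0 < b)
    (h : IsThreshold d β a b m) (hμ : m < μ) (hy : IsPeak d β a b μ y) :
    0 < longCycleGain d β a b y μ := by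
  obtain ⟨ν, hmν, hνμ⟩ := exists_between hμ
  obtain ⟨z, hz⟩ := h.exists_isPeak ν hmν
  exact (hz.longCycleGain_pos hd hβ ha hb hνμ).trans_le
    (sub_le_sub_right (hy.isMaxOn (mem_Ici.2 hz.pos.le)) _)

lemma zeroes_of_lt (hd : 1 ≤ d) (hβ : 0 < β) (ha : 0 < a) (h : IsThreshold d β a b m) (hμ : μ < m)
    (κ : ℝ≥0∞) : ∃ x, zeroes d β μ a b κ = {(x, 0)} := by
  have hmax := h.isMaxOn_zero μ hμ.le
  refine ⟨_, zeroes_eq_singleton hd hβ ha (zero_mem_longDensities κ)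
    (hmax.on_subset (longDensities_subset_Ici κ)) fun z hz hzmax => ?_⟩
  have h0z : reducedFunctional d β a b μ 0 ≤ reducedFunctional d β a b μ z :=
    hzmax (zero_mem_longDensities κ)
  by_contra hne
  exact h.not_isPeak μ hμ z ⟨lt_of_le_of_ne hz.1 (Ne.symm hne), fun w hw =>
    le_trans (hmax hw) h0z⟩

lemma zeroes_of_isPeak (hd : 1 ≤ d) (hβ : 0 < β) (ha : 0 < a) (hb : 0 < b)
    (h : IsThreshold d β a b m) (hμ : m < μ) {κ : ℝ≥0∞} (hy : IsPeak d β a b μ y)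
    (hyκ : y ∈ longDensities κ) : ∃ x y, 0 < y ∧ zeroes d β μ a b κ = {(x, y)} := by
  refine ⟨_, y, hy.pos, zeroes_eq_singleton hd hβ ha hyκ
    (hy.isMaxOn.on_subset (longDensities_subset_Ici κ)) fun z hz hzmax => ?_⟩
  have hyz : reducedFunctional d β a b μ y ≤ reducedFunctional d β a b μ z := hzmax hyκ
  have hz0 : z ≠ 0 := by
    rintro rfl
    exact (sub_pos.1 (h.longCycleGain_pos hd hβ ha hb hμ hy)).not_ge hyz
  exact IsPeak.unique hd hβ ha hb ⟨lt_of_le_of_ne hz.1 hz0.symm, fun w hw =>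
    le_trans (hy.isMaxOn hw) hyz⟩ hy

lemma isTransition_of_forall_isPeak_mem (hd : 1 ≤ d) (hβ : 0 < β) (ha : 0 < a) (hb : 0 < b)
    (h : IsThreshold d β a b m) {κ : ℝ≥0∞}
    (hmem : ∀ μ > m, ∀ y, IsPeak d β a b μ y → y ∈ longDensities κ) :
    IsTransition d β a b κ m := by
  refine ⟨fun μ hμ => h.zeroes_of_lt hd hβ ha hμ κ, fun μ hμ => ?_⟩
  obtain ⟨y, hy⟩ := h.exists_isPeak μ hμ
  exact h.zeroes_of_isPeak hd hβ ha hb hμ hy (hmem μ hμ y hy)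

end IsThreshold

lemma IsPeak.mem_longDensities_zero (h : IsPeak d β a b μ y) : y ∈ longDensities 0 :=
  longDensities_zero ▸ h.pos.le

lemma IsPeak.mem_longDensities (hd : 1 ≤ d) (hβ : 0 < β) (hb : 0 < b) (hab : b < a) (hκ : 0 < κ)
    (h : IsPeak d β a b μ y) (hμ : muR d β a b κ ≤ μ) : y ∈ longDensities (ENNReal.ofReal κ) :=
  (mem_longDensities_ofReal hκ).2 (.inr ((h.muR_le_iff hd hβ hb hab hκ).1 hμ))

lemma self_mem_longDensities (hκ : 0 < κ) : κ ∈ longDensities (ENNReal.ofReal κ) :=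
  (mem_longDensities_ofReal hκ).2 (.inr le_rfl)

lemma eq_zero_or_eq_of_lt_muR (hd : 1 ≤ d) (hβ : 0 < β) (hb : 0 < b) (hab : b < a) (hκ : 0 < κ)
    (hμ : μ < muR d β a b κ) (hy : y ∈ longDensities (ENNReal.ofReal κ))
    (hmax : IsMaxOn (reducedFunctional d β a b μ) (longDensities (ENNReal.ofReal κ)) y) :
    y = 0 ∨ y = κ := by
  refine ((mem_longDensities_ofReal hκ).1 hy).imp_right fun hκy => ?_
  by_contra! hne
  exact (muR_le_of_isMaxOn hd hβ hb hab hκ (lt_of_le_of_ne hκy hne.symm)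
    (hmax.on_subset fun z hz => (mem_longDensities_ofReal hκ).2 (.inr hz))).not_gt hμ

lemma isMaxOn_zero_of_longCycleGain_nonpos (hd : 1 ≤ d) (hβ : 0 < β) (hb : 0 < b) (hab : b < a)
    (hκ : 0 < κ) (hμ : μ < muR d β a b κ) (h : longCycleGain d β a b κ μ ≤ 0) :
    IsMaxOn (reducedFunctional d β a b μ) (longDensities (ENNReal.ofReal κ)) 0 := by
  obtain ⟨y, hy, hmax⟩ := exists_isMaxOn_longDensities (d := d) hd hβ (hb.trans hab) hab
    (ENNReal.ofReal κ) μ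
  rcases eq_zero_or_eq_of_lt_muR hd hβ hb hab hκ hμ hy hmax with rfl | rfl
  · exact hmax
  · exact fun z hz => le_trans (hmax hz) (sub_nonpos.1 h)

lemma isMaxOn_of_longCycleGain_nonneg (hd : 1 ≤ d) (hβ : 0 < β) (hb : 0 < b) (hab : b < a)
    (hκ : 0 < κ) (hμ : μ < muR d β a b κ) (h : 0 ≤ longCycleGain d β a b κ μ) :
    IsMaxOn (reducedFunctional d β a b μ) (longDensities (ENNReal.ofReal κ)) κ := by
  obtain ⟨y, hy, hmax⟩ := exists_isMaxOn_longDensities (d := d) hd hβ (hb.trans hab) hab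
    (ENNReal.ofReal κ) μ
  rcases eq_zero_or_eq_of_lt_muR hd hβ hb hab hκ hμ hy hmax with rfl | rfl
  · exact fun z hz => le_trans (hmax hz) (sub_nonneg.1 h)
  · exact hmax

lemma zeroes_of_longCycleGain_neg (hd : 1 ≤ d) (hβ : 0 < β) (hb : 0 < b) (hab : b < a)
    (hκ : 0 < κ) (hμ : μ < muR d β a b κ) (h : longCycleGain d β a b κ μ < 0) :
    ∃ x, zeroes d β μ a b (ENNReal.ofReal κ) = {(x, 0)} := by
  refine ⟨_, zeroes_eq_singleton hd hβ (hb.trans hab) (zero_mem_longDensities _)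
    (isMaxOn_zero_of_longCycleGain_nonpos hd hβ hb hab hκ hμ h.le) fun z hz hmax =>
      (eq_zero_or_eq_of_lt_muR hd hβ hb hab hκ hμ hz hmax).resolve_right ?_⟩
  rintro rfl
  exact (sub_neg.1 h).not_ge (hmax (zero_mem_longDensities _))

lemma zeroes_of_longCycleGain_pos (hd : 1 ≤ d) (hβ : 0 < β) (hb : 0 < b) (hab : b < a)
    (hκ : 0 < κ) (hμ : μ < muR d β a b κ) (h : 0 < longCycleGain d β a b κ μ) :
    ∃ x y, 0 < y ∧ zeroes d β μ a b (ENNReal.ofReal κ) = {(x, y)} := by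
  refine ⟨_, κ, hκ, zeroes_eq_singleton hd hβ (hb.trans hab) (self_mem_longDensities hκ)
    (isMaxOn_of_longCycleGain_nonneg hd hβ hb hab hκ hμ h.le) fun z hz hmax =>
      (eq_zero_or_eq_of_lt_muR hd hβ hb hab hκ hμ hz hmax).resolve_left ?_⟩
  rintro rfl
  exact (sub_pos.1 h).not_ge (hmax (self_mem_longDensities hκ))

namespace IsThreshold

lemma isPeak_of_muR_eq (hd : 1 ≤ d) (hβ : 0 < β) (hb : 0 < b) (hab : b < a)
    (h : IsThreshold d β a b m) (hκ : 0 < κ) (hm : muR d β a b κ = m) : IsPeak d β a b m κ := by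
  have ha : 0 < a := hb.trans hab
  have hsub : Ici κ ⊆ Ici (0 : ℝ) := Ici_subset_Ici.2 hκ.le
  have hle : reducedFunctional d β a b m 0 ≤ maxPressure d β a b (Ici κ) m := by
    refine le_of_tendsto_of_tendsto (b := 𝓝[>] m)
      (((continuous_reducedFunctional_potential hd hβ ha b 0).tendsto m).mono_left
        nhdsWithin_le_nhds)
      (((continuous_maxPressure hd hβ ha hab isClosed_Ici nonempty_Ici hsub).tendsto m).mono_left
        nhdsWithin_le_nhds) ?_
    filter_upwards [self_mem_nhdsWithin] with μ hμ
    obtain ⟨y, hy⟩ := h.exists_isPeak μ hμ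
    have hκy : κ ≤ y := (hy.muR_le_iff hd hβ hb hab hκ).1 (hm.trans_le (mem_Ioi.1 hμ).le)
    rw [maxPressure_eq (mem_Ici.2 hκy) (hy.isMaxOn.on_subset hsub)]
    exact hy.isMaxOn self_mem_Ici
  obtain ⟨y, hκy, hmax⟩ := exists_isMaxOn (d := d) hd hβ ha hab isClosed_Ici
    (nonempty_Ici (a := κ)) hsub m
  rw [maxPressure_eq hκy hmax] at hle
  have hpeak : IsPeak d β a b m y :=
    ⟨hκ.trans_le hκy, fun z hz => le_trans (h.isMaxOn_zero m le_rfl hz) hle⟩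
  exact IsPeak.eq_of_muR_eq hd hβ hb hab hκ (hm.symm ▸ hpeak) ▸ hpeak

lemma longCycleGain_neg_of_lt_muR (hd : 1 ≤ d) (hβ : 0 < β) (hb : 0 < b) (hab : b < a)
    (h : IsThreshold d β a b m) (hκ : 0 < κ) (hm : m < muR d β a b κ) :
    longCycleGain d β a b κ m < 0 := by
  by_contra! hgain
  have hpeak : IsPeak d β a b m κ :=
    ⟨hκ, fun z hz => le_trans (h.isMaxOn_zero m le_rfl hz) (sub_nonneg.1 hgain)⟩
  exact ((hpeak.muR_le_iff hd hβ hb hab hκ).2 le_rfl).not_gt hm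

lemma isPeak_muR (hd : 1 ≤ d) (hβ : 0 < β) (hb : 0 < b) (hab : b < a)
    (h : IsThreshold d β a b m) (hκ : 0 < κ) (hm : m < muR d β a b κ) :
    IsPeak d β a b (muR d β a b κ) κ := by
  obtain ⟨y, hy⟩ := h.exists_isPeak _ hm
  exact hy.eq_of_muR_eq hd hβ hb hab hκ ▸ hy

lemma exists_longCycleGain_eq_zero (hd : 1 ≤ d) (hβ : 0 < β) (hb : 0 < b) (hab : b < a)
    (h : IsThreshold d β a b m) (hκ : 0 < κ) (hm : m < muR d β a b κ) :
    ∃ mκ ∈ Ioo m (muR d β a b κ), longCycleGain d β a b κ mκ = 0 ∧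
      (∀ μ < mκ, longCycleGain d β a b κ μ < 0) ∧ ∀ μ > mκ, 0 < longCycleGain d β a b κ μ := by
  have ha : 0 < a := hb.trans hab
  obtain ⟨mκ, hmκ, hzero⟩ := intermediate_value_Ioo hm.le
    (fun μ _ => (hasDerivAt_longCycleGain hd hβ ha b κ μ).continuousAt.continuousWithinAt)
    ⟨h.longCycleGain_neg_of_lt_muR hd hβ hb hab hκ hm,
      h.longCycleGain_pos hd hβ ha hb hm (h.isPeak_muR hd hβ hb hab hκ hm)⟩
  refine ⟨mκ, hmκ, hzero, fun μ hμ => ?_, fun μ hμ => ?_⟩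
  · exact (longCycleGain_lt_of_nonpos hd hβ ha hb hκ hμ hzero.le).trans_eq hzero
  · by_contra! hle
    exact hle.not_gt (hzero.symm.trans_lt (longCycleGain_lt_of_nonpos hd hβ ha hb hκ hμ hle))

lemma exists_isTransition_of_lt_muR (hd : 1 ≤ d) (hβ : 0 < β) (hb : 0 < b) (hab : b < a)
    (h : IsThreshold d β a b m) (hκ : 0 < κ) (hm : m < muR d β a b κ) :
    ∃ mκ ∈ Ioo m (muR d β a b κ), IsTransition d β a b (ENNReal.ofReal κ) mκ ∧
      (∀ μ ≤ mκ, IsMaxOn (reducedFunctional d β a b μ) (longDensities (ENNReal.ofReal κ)) 0) ∧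
      ∀ μ ∈ Icc mκ (muR d β a b κ),
        IsMaxOn (reducedFunctional d β a b μ) (longDensities (ENNReal.ofReal κ)) κ := by
  have ha : 0 < a := hb.trans hab
  obtain ⟨mκ, hmκ, hzero, hneg, hpos⟩ := h.exists_longCycleGain_eq_zero hd hβ hb hab hκ hm
  refine ⟨mκ, hmκ, ⟨fun μ hμ => ?_, fun μ hμ => ?_⟩, fun μ hμ => ?_, fun μ hμ => ?_⟩
  · exact zeroes_of_longCycleGain_neg hd hβ hb hab hκ (hμ.trans hmκ.2) (hneg μ hμ)
  · rcases lt_or_ge μ (muR d β a b κ) with hμr | hμr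
    · exact zeroes_of_longCycleGain_pos hd hβ hb hab hκ hμr (hpos μ hμ)
    · obtain ⟨y, hy⟩ := h.exists_isPeak μ (hmκ.1.trans hμ)
      exact h.zeroes_of_isPeak hd hβ ha hb (hmκ.1.trans hμ) hy
        (hy.mem_longDensities hd hβ hb hab hκ hμr)
  · exact isMaxOn_zero_of_longCycleGain_nonpos hd hβ hb hab hκ (hμ.trans_lt hmκ.2)
      (hμ.eq_or_lt.elim (fun heq => heq ▸ hzero.le) fun hlt => (hneg μ hlt).le)
  · rcases hμ.2.eq_or_lt with rfl | hμr
    · exact (h.isPeak_muR hd hβ hb hab hκ hm).isMaxOn.on_subset (longDensities_subset_Ici _)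
    · exact isMaxOn_of_longCycleGain_nonneg hd hβ hb hab hκ hμr
        (hμ.1.eq_or_lt.elim (fun heq => heq ▸ hzero.ge) fun hlt => (hpos μ hlt).le)

lemma exists_isTransition (hd : 1 ≤ d) (hβ : 0 < β) (hb : 0 < b) (hab : b < a)
    (h : IsThreshold d β a b m) (hκ : 0 < κ) :
    ∃ mκ, IsTransition d β a b (ENNReal.ofReal κ) mκ ∧
      (muR d β a b κ ≤ m → mκ = m) ∧ (m < muR d β a b κ → mκ ∈ Ioo m (muR d β a b κ)) ∧
      (∀ μ ≤ mκ, IsMaxOn (reducedFunctional d β a b μ) (longDensities (ENNReal.ofReal κ)) 0) ∧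
      ∀ μ ∈ Icc mκ (muR d β a b κ),
        IsMaxOn (reducedFunctional d β a b μ) (longDensities (ENNReal.ofReal κ)) κ := by
  rcases le_or_gt (muR d β a b κ) m with hm | hm
  · refine ⟨m, h.isTransition_of_forall_isPeak_mem hd hβ (hb.trans hab) hb fun μ hμ y hy =>
      hy.mem_longDensities hd hβ hb hab hκ (hm.trans hμ.le), fun _ => rfl,
      fun hlt => absurd hm hlt.not_ge, fun μ hμ =>
      (h.isMaxOn_zero μ hμ).on_subset (longDensities_subset_Ici _), fun μ hμ => ?_⟩
    obtain rfl : μ = m := le_antisymm (hμ.2.trans hm) hμ.1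
    exact (h.isPeak_of_muR_eq hd hβ hb hab hκ (le_antisymm hm hμ.2)).isMaxOn.on_subset
      (longDensities_subset_Ici _)
  · obtain ⟨mκ, hmκ, htrans⟩ := h.exists_isTransition_of_lt_muR hd hβ hb hab hκ hm
    exact ⟨mκ, htrans.1, fun hle => absurd hm hle.not_gt, fun _ => hmκ, htrans.2⟩

end IsThreshold

end Transition

/-! ### Upper bound on the partition function -/

lemma subset_finsupp_biUnion_support {ι : Type*} [DecidableEq ι] (F : Finset (ι →₀ ℕ)) :
    F ⊆ (F.biUnion Finsupp.support).finsupp fun _ =>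
      Finset.range ((F.sup fun N => N.support.sup N) + 1) := by
  refine fun N hN => Finset.mem_finsupp_iff.2 ⟨Finset.subset_biUnion_of_mem _ hN, fun i _ => ?_⟩
  rw [Finset.mem_range, Nat.lt_succ_iff]
  by_cases hiN : i ∈ N.support
  · exact (Finset.le_sup (f := N) hiN).trans
      (Finset.le_sup (f := fun N : ι →₀ ℕ => N.support.sup N) hN)
  · exact (Finsupp.notMem_support_iff.1 hiN).trans_le (Nat.zero_le _)

lemma sum_finsupp_prod {ι R : Type*} [CommSemiring R] {f : ι → ℕ → R} (hf : ∀ i, f i 0 = 1)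
    (J : Finset ι) (t : ι → Finset ℕ) :
    ∑ N ∈ J.finsupp t, N.prod f = ∏ i ∈ J, ∑ n ∈ t i, f i n := by
  classical
  have hprod : ∀ N ∈ J.finsupp t, N.prod f = ∏ i ∈ J, f i (N i) := fun N hN =>
    Finsupp.prod_of_support_subset N (Finset.mem_finsupp_iff.1 hN).1 _ fun i _ => hf i
  rw [Finset.sum_congr rfl hprod, Finset.prod_sum, Finset.finsupp, Finset.sum_map]
  refine Finset.sum_congr (by congr!) fun p _ => ?_
  rw [← Finset.prod_attach]
  exact Finset.prod_congr rfl fun i _ => by simp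

lemma sum_prod_pow_div_factorial_le_exp {ι : Type*} {θ : ι → ℝ} (h0 : ∀ i, 0 ≤ θ i)
    (hθ : Summable θ) (F : Finset (ι →₀ ℕ)) :
    ∑ N ∈ F, (N.prod fun i n => θ i ^ n / (n.factorial : ℝ)) ≤ Real.exp (∑' i, θ i) := by
  classical
  have hterm : ∀ i n, 0 ≤ θ i ^ n / (n.factorial : ℝ) := fun i n =>
    div_nonneg (pow_nonneg (h0 i) _) (Nat.cast_nonneg _)
  set J := F.biUnion Finsupp.support
  set t := fun _ : ι => Finset.range ((F.sup fun N => N.support.sup N) + 1)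
  calc ∑ N ∈ F, (N.prod fun i n => θ i ^ n / (n.factorial : ℝ))
      ≤ ∑ N ∈ J.finsupp t, (N.prod fun i n => θ i ^ n / (n.factorial : ℝ)) :=
        Finset.sum_le_sum_of_subset_of_nonneg (subset_finsupp_biUnion_support F)
          fun N _ _ => Finset.prod_nonneg fun i _ => hterm i (N i)
    _ = ∏ i ∈ J, ∑ n ∈ t i, θ i ^ n / (n.factorial : ℝ) :=
        sum_finsupp_prod (fun i => by rw [pow_zero, Nat.factorial_zero, Nat.cast_one, div_one]) J t
    _ ≤ ∏ i ∈ J, Real.exp (θ i) :=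
        Finset.prod_le_prod (fun i _ => Finset.sum_nonneg fun n _ => hterm i n)
          fun i _ => Real.sum_le_exp_of_nonneg (h0 i) _
    _ = Real.exp (∑ i ∈ J, θ i) := (Real.exp_sum J θ).symm
    _ ≤ Real.exp (∑' i, θ i) := Real.exp_le_exp.2 (hθ.sum_le_tsum J fun i _ => h0 i)

/-- The weight of the cycle counts `N` under the reference process at `α = 0`, without its
normalisation `exp (-V ∑ q_k)`. -/
noncomputable def refWeight (d : ℕ) (β V : ℝ) (N : CycleCounts) : ℝ :=
  N.prod fun k n => (V * cycleWeight d β k) ^ n / (n.factorial : ℝ)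

/-- The number of particles per volume in the cycle counts `N`. -/
noncomputable def particleDensity (V : ℝ) (N : CycleCounts) : ℝ :=
  N.sum fun k n => (k : ℝ) * ((n : ℝ) / V)

/-- The sum `∑_{k ≥ m} k² λ_k²` of the counter term of the Hamiltonian. -/
noncomputable def counterTerm (V : ℝ) (m : ℕ) (N : CycleCounts) : ℝ :=
  N.sum fun k n => if m ≤ (k : ℕ) then (k : ℝ) ^ 2 * ((n : ℝ) / V) ^ 2 else 0

/-- The contribution of the cycle counts `N` to the partition function. The chemical potential `α`
of the reference process cancels against the one in the Hamiltonian. -/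
noncomputable def boltzmannWeight (d : ℕ) (β μ a b V : ℝ) (m : ℕ) (N : CycleCounts) : ℝ :=
  refWeight d β V N * Real.exp (β * V * (μ * particleDensity V N -
    a / 2 * particleDensity V N ^ 2 + b / 2 * counterTerm V m N))

/-- The number of particles in cycles of length at least `m`. -/
def longMass (m : ℕ) (N : CycleCounts) : ℕ := N.sum fun k n => if m ≤ (k : ℕ) then k * n else 0

/-- The number of particles in cycles of length less than `m`. -/
def shortMass (m : ℕ) (N : CycleCounts) : ℕ := N.sum fun k n => if m ≤ (k : ℕ) then 0 else k * n

/-- The total weight of the cycles of length at least `m`. -/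
noncomputable def tailWeight (d : ℕ) (β : ℝ) (m : ℕ) : ℝ :=
  ∑' k : ℕ+, if m ≤ (k : ℕ) then cycleWeight d β k else 0

section UpperBound

variable {d : ℕ} {β a b V μ η S s : ℝ} {m : ℕ}

lemma refWeight_mul_exp_sum (d : ℕ) (β V : ℝ) (c : ℕ+ → ℝ) (N : CycleCounts) :
    refWeight d β V N * Real.exp (N.sum fun k n => n * c k) =
      N.prod fun k n => (V * cycleWeight d β k * Real.exp (c k)) ^ n / (n.factorial : ℝ) := by
  unfold refWeight Finsupp.prod Finsupp.sum
  rw [Real.exp_sum, ← Finset.prod_mul_distrib]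
  refine Finset.prod_congr rfl fun k _ => ?_
  dsimp only
  rw [Real.exp_nat_mul, mul_pow (V * _), div_mul_eq_mul_div]

lemma refProb_mul_exp_eq (hV : 0 < V) (d : ℕ) (α β μ a b : ℝ) (m : ℕ) (N : CycleCounts) :
    Real.exp (V * totalWeight d β α) *
      (refProb d β α V N * Real.exp (-(β * hamiltonian α μ a b V m N))) =
      boltzmannWeight d β μ a b V m N := by
  have hsum : (N.sum fun k n => (n : ℝ) * (β * α * k)) = β * α * V * particleDensity V N := by
    unfold particleDensity Finsupp.sum
    rw [Finset.mul_sum]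
    refine Finset.sum_congr rfl fun k _ => ?_
    field_simp
  have hham : hamiltonian α μ a b V m N = V * (-(μ - α) * particleDensity V N +
    a / 2 * particleDensity V N ^ 2 - b / 2 * counterTerm V m N) := rfl
  rw [refProb, ← refWeight_mul_exp_sum d β V, hsum, boltzmannWeight, hham, ← mul_assoc, ← mul_assoc,
    ← Real.exp_add, add_neg_cancel, Real.exp_zero, one_mul, mul_assoc, ← Real.exp_add]
  ring_nf

lemma partitionFunction_eq (hV : 0 < V) (d : ℕ) (α β μ a b : ℝ) (m : ℕ) :
    partitionFunction d β α μ a b V m = ∑' N, boltzmannWeight d β μ a b V m N := by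
  unfold partitionFunction refExpectation
  rw [← tsum_mul_left]
  exact tsum_congr (refProb_mul_exp_eq hV d α β μ a b m)

lemma refWeight_pos (hβ : 0 < β) (hV : 0 < V) (N : CycleCounts) : 0 < refWeight d β V N :=
  Finset.prod_pos fun k _ => div_pos (pow_pos (mul_pos hV (cycleWeight_pos hβ k)) _)
    (by exact_mod_cast Nat.factorial_pos _)

lemma boltzmannWeight_pos (hβ : 0 < β) (hV : 0 < V) (μ a b : ℝ) (m : ℕ) (N : CycleCounts) :
    0 < boltzmannWeight d β μ a b V m N :=
  mul_pos (refWeight_pos hβ hV N) (Real.exp_pos _)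

lemma particleDensity_eq (V : ℝ) (m : ℕ) (N : CycleCounts) :
    particleDensity V N = shortMass m N / V + longMass m N / V := by
  unfold particleDensity shortMass longMass Finsupp.sum
  rw [← add_div, ← Nat.cast_add, ← Finset.sum_add_distrib, Nat.cast_sum, Finset.sum_div]
  refine Finset.sum_congr rfl fun k _ => ?_
  dsimp only
  split_ifs <;> push_cast <;> ring

lemma counterTerm_le (hV : 0 ≤ V) (m : ℕ) (N : CycleCounts) :
    counterTerm V m N ≤ (longMass m N / V) ^ 2 := by
  unfold counterTerm longMass Finsupp.sum
  rw [Nat.cast_sum, Finset.sum_div]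
  refine le_trans (le_of_eq ?_) (Finset.sum_sq_le_sq_sum_of_nonneg fun k _ => by positivity)
  refine Finset.sum_congr rfl fun k _ => ?_
  dsimp only
  split_ifs <;> push_cast <;> ring

lemma longMass_eq_zero_or_le (m : ℕ) (N : CycleCounts) : longMass m N = 0 ∨ m ≤ longMass m N := by
  by_cases! h : ∃ k ∈ N.support, m ≤ (k : ℕ)
  · obtain ⟨k, hk, hm⟩ := h
    have hle : (if m ≤ (k : ℕ) then (k : ℕ) * N k else 0) ≤ longMass m N :=
      Finset.single_le_sum (f := fun k : ℕ+ => if m ≤ (k : ℕ) then (k : ℕ) * N k else 0)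
        (fun _ _ => Nat.zero_le _) hk
    rw [if_pos hm] at hle
    exact .inr (hm.trans ((Nat.le_mul_of_pos_right _
      (Nat.pos_of_ne_zero (Finsupp.mem_support_iff.1 hk))).trans hle))
  · exact .inl (Finset.sum_eq_zero fun k hk => if_neg (not_le.2 (h k hk)))

lemma longMass_div_mem_longDensities (hV : 0 < V) (m : ℕ) (N : CycleCounts) :
    longMass m N / V ∈ longDensities (ENNReal.ofReal (m / V)) := by
  refine ⟨by positivity, (longMass_eq_zero_or_le m N).imp (fun h => ?_) fun h => ?_⟩
  · rw [h, Nat.cast_zero, zero_div]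
  · gcongr

/-- Completing the square in `x` and using that the effective potential attains `p_sub`. -/
lemma energy_le_reducedFunctional_add (hd : 1 ≤ d) (hβ : 0 < β) (ha : 0 < a) (b μ x y : ℝ) :
    μ * (x + y) - a / 2 * (x + y) ^ 2 + b / 2 * y ^ 2 ≤ reducedFunctional d β a b μ y +
      effectivePotential d β a (μ - a * y) * x -
        idealPressure d β (effectivePotential d β a (μ - a * y)) := by
  rw [reducedFunctional, pSub_eq hd hβ ha]
  set σ := effectivePotential d β a (μ - a * y)
  have hsq : (μ - a * y - σ) ^ 2 / (2 * a) + idealPressure d β σ + μ * y - (a - b) / 2 * y ^ 2 +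
      σ * x - idealPressure d β σ - (μ * (x + y) - a / 2 * (x + y) ^ 2 + b / 2 * y ^ 2) =
      a / 2 * (x - (μ - a * y - σ) / a) ^ 2 := by
    field_simp
    ring
  linarith [show 0 ≤ a / 2 * (x - (μ - a * y - σ) / a) ^ 2 by positivity]

lemma summable_tailWeight (hd : 1 ≤ d) (hβ : 0 < β) (m : ℕ) :
    Summable fun k : ℕ+ => if m ≤ (k : ℕ) then cycleWeight d β k else 0 := by
  refine (summable_cycleWeight hd β).of_nonneg_of_le (fun k => ?_) fun k => ?_
  · split_ifs
    exacts [(cycleWeight_pos hβ k).le, le_rfl]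
  · split_ifs
    exacts [le_rfl, (cycleWeight_pos hβ k).le]

lemma tendsto_tailWeight (hd : 1 ≤ d) (hβ : 0 < β) : Tendsto (tailWeight d β) atTop (𝓝 0) := by
  rw [← tsum_zero (β := ℕ+)]
  refine tendsto_tsum_of_dominated_convergence (summable_cycleWeight hd β) (fun k => ?_)
    (.of_forall fun m k => ?_)
  · refine tendsto_const_nhds.congr' ?_
    filter_upwards [eventually_gt_atTop (k : ℕ)] with m hm
    rw [if_neg (not_le.2 hm)]
  · have hw := (cycleWeight_pos (d := d) hβ k).le
    split_ifs
    · rw [Real.norm_of_nonneg hw]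
    · rwa [norm_zero]

lemma sum_refWeight_mul_exp_shortMass_le (hd : 1 ≤ d) (hβ : 0 < β) (hV : 0 < V) (m : ℕ)
    (hs : s ≤ 0) (F : Finset CycleCounts) :
    ∑ N ∈ F, refWeight d β V N * Real.exp (β * s * shortMass m N) ≤
      Real.exp (β * V * idealPressure d β s + V * tailWeight d β m) := by
  set c : ℕ+ → ℝ := fun k => if m ≤ (k : ℕ) then 0 else β * s * k with hc
  have hmass : ∀ N : CycleCounts, β * s * shortMass m N = N.sum fun k n => (n : ℝ) * c k := by
    intro N
    unfold shortMass Finsupp.sum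
    rw [Nat.cast_sum, Finset.mul_sum]
    refine Finset.sum_congr rfl fun k _ => ?_
    simp only [hc]
    split_ifs <;> push_cast <;> ring
  have hnn : ∀ k, 0 ≤ V * cycleWeight d β k * Real.exp (c k) := fun k =>
    (mul_pos (mul_pos hV (cycleWeight_pos hβ k)) (Real.exp_pos _)).le
  have hle : ∀ k, V * cycleWeight d β k * Real.exp (c k) ≤
      V * (cycleWeight d β k * Real.exp (β * s * k)) +
        V * (if m ≤ (k : ℕ) then cycleWeight d β k else 0) := fun k => by
    have hw := mul_pos hV (mul_pos (cycleWeight_pos (d := d) hβ k) (Real.exp_pos (β * s * k)))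
    simp only [hc]
    split_ifs
    · rw [Real.exp_zero]
      linarith
    · linarith
  have hshort := (summable_cycleWeight_mul_exp hd hβ hs).mul_left V
  have htail := (summable_tailWeight hd hβ m).mul_left V
  have hθ := (hshort.add htail).of_nonneg_of_le hnn hle
  simp only [hmass, refWeight_mul_exp_sum]
  refine (sum_prod_pow_div_factorial_le_exp hnn hθ F).trans (Real.exp_le_exp.2 ?_)
  refine (hθ.tsum_le_tsum hle (hshort.add htail)).trans_eq ?_
  rw [hshort.tsum_add htail, tsum_mul_left, tsum_mul_left, idealPressure, totalWeight, tailWeight]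
  field_simp

/-- Raising the chemical potential by `η` gains the factor `exp (β η)` for every particle in a long
cycle, which makes the sum over the number of these particles geometric. -/
lemma boltzmannWeight_le (hd : 1 ≤ d) (hβ : 0 < β) (ha : 0 < a) (hb : 0 ≤ b) (hV : 0 < V)
    (hη : 0 ≤ η) (m : ℕ) (N : CycleCounts)
    (hS : reducedFunctional d β a b (μ + η) (longMass m N / V) ≤ S) :
    boltzmannWeight d β μ a b V m N ≤
      Real.exp (β * V * (S - idealPressure d β
        (effectivePotential d β a (μ + η - a * (longMass m N / V))))) *
        Real.exp (-(β * η)) ^ longMass m N *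
        (refWeight d β V N * Real.exp (β *
          effectivePotential d β a (μ + η - a * (longMass m N / V)) * shortMass m N)) := by
  set x : ℝ := shortMass m N / V with hx
  set y : ℝ := longMass m N / V with hy
  set σ := effectivePotential d β a (μ + η - a * y) with hσ
  have henergy : μ * particleDensity V N - a / 2 * particleDensity V N ^ 2 +
      b / 2 * counterTerm V m N ≤ S - idealPressure d β σ - η * y + σ * x := by
    have hle := energy_le_reducedFunctional_add (d := d) hd hβ ha b (μ + η) x y
    have hcounter := mul_le_mul_of_nonneg_left (counterTerm_le hV.le m N)
      (div_nonneg hb zero_le_two)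
    have hηx : 0 ≤ η * x := by positivity
    rw [particleDensity_eq V m N, ← hx, ← hy]
    rw [← hσ] at hle
    rw [← hy] at hcounter
    linarith
  have hexponent : β * V * (S - idealPressure d β σ - η * y + σ * x) =
      β * V * (S - idealPressure d β σ) + longMass m N * -(β * η) + β * σ * shortMass m N := by
    rw [hx, hy]
    field_simp
    ring
  calc boltzmannWeight d β μ a b V m N
      ≤ refWeight d β V N *
          Real.exp (β * V * (S - idealPressure d β σ - η * y + σ * x)) :=
        mul_le_mul_of_nonneg_left (Real.exp_le_exp.2
          (mul_le_mul_of_nonneg_left henergy (mul_pos hβ hV).le)) (refWeight_pos hβ hV N).le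
    _ = _ := by
        rw [hexponent, Real.exp_add, Real.exp_add, Real.exp_nat_mul]
        ring

lemma sum_boltzmannWeight_longMass_eq_le (hd : 1 ≤ d) (hβ : 0 < β) (ha : 0 < a) (hb : 0 ≤ b)
    (hV : 0 < V) (hη : 0 ≤ η)
    (hS : ∀ y ∈ longDensities (ENNReal.ofReal (m / V)), reducedFunctional d β a b (μ + η) y ≤ S)
    (F : Finset CycleCounts) (n : ℕ) :
    ∑ N ∈ F with longMass m N = n, boltzmannWeight d β μ a b V m N ≤
      Real.exp (β * V * S + V * tailWeight d β m) * Real.exp (-(β * η)) ^ n := by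
  set σ := effectivePotential d β a (μ + η - a * (n / V))
  calc ∑ N ∈ F with longMass m N = n, boltzmannWeight d β μ a b V m N
      ≤ ∑ N ∈ F with longMass m N = n,
          Real.exp (β * V * (S - idealPressure d β σ)) * Real.exp (-(β * η)) ^ n *
            (refWeight d β V N * Real.exp (β * σ * shortMass m N)) := by
        refine Finset.sum_le_sum fun N hN => ?_
        obtain rfl := (Finset.mem_filter.1 hN).2
        exact boltzmannWeight_le hd hβ ha hb hV hη m N
          (hS _ (longMass_div_mem_longDensities hV m N))
    _ ≤ Real.exp (β * V * (S - idealPressure d β σ)) * Real.exp (-(β * η)) ^ n *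
          Real.exp (β * V * idealPressure d β σ + V * tailWeight d β m) := by
        rw [← Finset.mul_sum]
        exact mul_le_mul_of_nonneg_left (sum_refWeight_mul_exp_shortMass_le hd hβ hV m
          (effectivePotential_nonpos hβ) _) (by positivity)
    _ = _ := by
        rw [mul_right_comm, ← Real.exp_add]
        ring_nf

lemma exp_neg_mul_lt_one (hβ : 0 < β) (hη : 0 < η) : Real.exp (-(β * η)) < 1 :=
  Real.exp_lt_one_iff.2 (neg_neg_of_pos (mul_pos hβ hη))

lemma sum_boltzmannWeight_le (hd : 1 ≤ d) (hβ : 0 < β) (ha : 0 < a) (hb : 0 ≤ b) (hV : 0 < V)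
    (hη : 0 < η)
    (hS : ∀ y ∈ longDensities (ENNReal.ofReal (m / V)), reducedFunctional d β a b (μ + η) y ≤ S)
    (F : Finset CycleCounts) :
    ∑ N ∈ F, boltzmannWeight d β μ a b V m N ≤
      Real.exp (β * V * S + V * tailWeight d β m) * (1 - Real.exp (-(β * η)))⁻¹ := by
  have hr := exp_neg_mul_lt_one hβ hη
  rw [← Finset.sum_fiberwise_of_maps_to (t := F.image (longMass m))
    (fun N hN => Finset.mem_image_of_mem _ hN)]
  refine (Finset.sum_le_sum fun n _ =>
    sum_boltzmannWeight_longMass_eq_le hd hβ ha hb hV hη.le hS F n).trans ?_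
  rw [← Finset.mul_sum, ← tsum_geometric_of_lt_one (Real.exp_pos _).le hr]
  exact mul_le_mul_of_nonneg_left ((summable_geometric_of_lt_one (Real.exp_pos _).le hr).sum_le_tsum
    _ fun n _ => pow_nonneg (Real.exp_pos _).le n) (Real.exp_pos _).le

lemma summable_boltzmannWeight (hd : 1 ≤ d) (hβ : 0 < β) (hb : 0 ≤ b) (hab : b < a) (hV : 0 < V)
    (μ : ℝ) (m : ℕ) : Summable (boltzmannWeight d β μ a b V m) := by
  have ha := hb.trans_lt hab
  obtain ⟨y, -, hmax⟩ := exists_isMaxOn_longDensities (d := d) hd hβ ha hab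
    (ENNReal.ofReal (m / V)) (μ + 1)
  exact summable_of_sum_le (fun N => (boltzmannWeight_pos hβ hV μ a b m N).le)
    (sum_boltzmannWeight_le hd hβ ha hb hV one_pos fun z hz => hmax hz)

lemma boltzmannWeight_le_partitionFunction (hd : 1 ≤ d) (hβ : 0 < β) (hb : 0 ≤ b) (hab : b < a)
    (hV : 0 < V) (α μ : ℝ) (m : ℕ) (N : CycleCounts) :
    boltzmannWeight d β μ a b V m N ≤ partitionFunction d β α μ a b V m := by
  rw [partitionFunction_eq hV]
  exact (summable_boltzmannWeight hd hβ hb hab hV μ m).le_tsum N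
    fun N _ => (boltzmannWeight_pos hβ hV μ a b m N).le

lemma finitePressure_le (hd : 1 ≤ d) (hβ : 0 < β) (hb : 0 ≤ b) (hab : b < a) (hV : 0 < V) (α : ℝ)
    (hη : 0 < η)
    (hS : ∀ y ∈ longDensities (ENNReal.ofReal (m / V)), reducedFunctional d β a b (μ + η) y ≤ S) :
    finitePressure d β α μ a b V m ≤ S + tailWeight d β m / β +
      Real.log (1 - Real.exp (-(β * η)))⁻¹ / (β * V) := by
  have hpos : 0 < partitionFunction d β α μ a b V m :=
    (boltzmannWeight_pos hβ hV μ a b m 0).trans_le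
      (boltzmannWeight_le_partitionFunction hd hβ hb hab hV α μ m 0)
  have hle : partitionFunction d β α μ a b V m ≤
      Real.exp (β * V * S + V * tailWeight d β m) * (1 - Real.exp (-(β * η)))⁻¹ := by
    rw [partitionFunction_eq hV]
    exact (summable_boltzmannWeight hd hβ hb hab hV μ m).tsum_le_of_sum_le
      (sum_boltzmannWeight_le hd hβ (hb.trans_lt hab) hb hV hη hS)
  have hr : 1 - Real.exp (-(β * η)) ≠ 0 := (sub_pos.2 (exp_neg_mul_lt_one hβ hη)).ne'
  calc finitePressure d β α μ a b V m
      ≤ 1 / (β * V) * Real.log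
          (Real.exp (β * V * S + V * tailWeight d β m) * (1 - Real.exp (-(β * η)))⁻¹) :=
        mul_le_mul_of_nonneg_left (Real.log_le_log hpos hle) (by positivity)
    _ = _ := by
        rw [Real.log_mul (Real.exp_pos _).ne' (inv_ne_zero hr), Real.log_exp]
        field_simp

end UpperBound

/-! ### Lower bound on the partition function -/

lemma tendsto_log_div_atTop : Tendsto (fun x : ℝ => Real.log x / x) atTop (𝓝 0) :=
  Real.isLittleO_log_id_atTop.tendsto_div_nhds_zero

lemma tendsto_log_factorial_div_sub_log :
    Tendsto (fun n : ℕ => Real.log n.factorial / n - Real.log n) atTop (𝓝 (-1)) := by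
  have hstirling : Tendsto (fun n : ℕ => Real.log (Stirling.stirlingSeq n) / n) atTop (𝓝 0) :=
    (Stirling.tendsto_stirlingSeq_sqrt_pi.log (Real.sqrt_pos.2 Real.pi_pos).ne').div_atTop
      tendsto_natCast_atTop_atTop
  have htwo : Tendsto (fun n : ℕ => (2 : ℝ) * n) atTop atTop :=
    tendsto_natCast_atTop_atTop.const_mul_atTop two_pos
  have hlim := (hstirling.add (tendsto_log_div_atTop.comp htwo)).sub_const 1
  rw [add_zero, zero_sub] at hlim
  refine hlim.congr' ?_
  filter_upwards [eventually_ge_atTop 1] with n hn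
  have hn0 : (n : ℝ) ≠ 0 := by positivity
  rw [Function.comp_apply, Stirling.log_stirlingSeq_formula, Real.log_div hn0 (Real.exp_pos 1).ne',
    Real.log_exp]
  field_simp
  ring

/-- The exponential rate `t (1 + log q - log t)` of the weight `(V q)^n / n!` of `n ∼ t V` cycles,
each of weight `q`. -/
noncomputable def cycleEntropy (q t : ℝ) : ℝ := t + t * Real.log q - t * Real.log t

section CycleEntropy

variable {q t : ℝ}

lemma tendsto_log_pow_div_factorial (hq : 0 < q) (ht : 0 ≤ t) :
    Tendsto (fun V : ℝ => Real.log ((V * q) ^ ⌊t * V⌋₊ / (⌊t * V⌋₊.factorial : ℝ)) / V) atTop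
      (𝓝 (cycleEntropy q t)) := by
  rcases ht.eq_or_lt with rfl | ht
  · simp [cycleEntropy]
  have hcount : Tendsto (fun V : ℝ => ⌊t * V⌋₊) atTop atTop :=
    tendsto_nat_floor_atTop.comp (tendsto_id.const_mul_atTop ht)
  have hdensity : Tendsto (fun V : ℝ => (⌊t * V⌋₊ : ℝ) / V) atTop (𝓝 t) :=
    tendsto_nat_floor_mul_div_atTop ht.le
  have hlim : Tendsto (fun V : ℝ => (⌊t * V⌋₊ : ℝ) / V * (Real.log q -
      Real.log ((⌊t * V⌋₊ : ℝ) / V) -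
        (Real.log (⌊t * V⌋₊).factorial / (⌊t * V⌋₊ : ℝ) - Real.log (⌊t * V⌋₊ : ℝ)))) atTop
      (𝓝 (t * (Real.log q - Real.log t - -1))) :=
    hdensity.mul (((hdensity.log ht.ne').const_sub _).sub
      (tendsto_log_factorial_div_sub_log.comp hcount))
  rw [show t * (Real.log q - Real.log t - -1) = cycleEntropy q t by unfold cycleEntropy; ring]
    at hlim
  refine hlim.congr' ?_
  filter_upwards [hcount.eventually_ge_atTop 1, eventually_gt_atTop 0] with V hn hV
  have hn0 : (0 : ℝ) < ⌊t * V⌋₊ := by exact_mod_cast hn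
  rw [Real.log_div hn0.ne' hV.ne', Real.log_div (pow_pos (mul_pos hV hq) _).ne' (by positivity),
    Real.log_pow, Real.log_mul hV.ne' hq.ne']
  field_simp
  ring

lemma cycleEntropy_mul_exp (hq : 0 < q) (c : ℝ) :
    cycleEntropy q (q * Real.exp c) = q * Real.exp c - c * (q * Real.exp c) := by
  rw [cycleEntropy, Real.log_mul hq.ne' (Real.exp_pos c).ne', Real.log_exp]
  ring

lemma mul_log_le_cycleEntropy (ht : 0 ≤ t) (ht1 : t ≤ 1) : t * Real.log q ≤ cycleEntropy q t := by
  have hlog := mul_nonpos_of_nonneg_of_nonpos ht (Real.log_nonpos ht ht1)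
  unfold cycleEntropy
  linarith

end CycleEntropy

section LongCycle

variable {d : ℕ} {β : ℝ}

lemma tendsto_cycleLength_atTop : Tendsto (fun k : ℕ+ => (k : ℝ)) atTop atTop :=
  tendsto_natCast_atTop_atTop.comp tendsto_PNat_val_atTop_atTop

lemma log_cycleWeight (hβ : 0 < β) (k : ℕ+) : Real.log (cycleWeight d β k) =
    -Real.log ((4 * Real.pi * β) ^ ((d : ℝ) / 2)) - (1 + (d : ℝ) / 2) * Real.log k := by
  have := Real.pi_pos
  have hk := cycleLength_pos k
  rw [cycleWeight, one_div, Real.log_inv, Real.log_mul (by positivity) (by positivity),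
    Real.log_rpow hk]
  ring

lemma tendsto_log_cycleWeight_div (hβ : 0 < β) :
    Tendsto (fun k : ℕ+ => Real.log (cycleWeight d β k) / k) atTop (𝓝 0) := by
  have hlim := (tendsto_cycleLength_atTop.const_div_atTop
    (-Real.log ((4 * Real.pi * β) ^ ((d : ℝ) / 2)))).sub
      ((tendsto_log_div_atTop.comp tendsto_cycleLength_atTop).const_mul (1 + (d : ℝ) / 2))
  rw [mul_zero, sub_zero] at hlim
  refine hlim.congr fun k => ?_
  rw [log_cycleWeight hβ, Function.comp_apply]
  ring

lemma neg_mul_abs_le_cycleEntropy_div {x r : ℝ} (hr : 0 ≤ r) (hrx : r ≤ x) {k : ℕ+}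
    (hxk : x ≤ k) : -(x * |Real.log (cycleWeight d β k) / k|) ≤
      cycleEntropy (cycleWeight d β k) (r / k) := by
  have hk := cycleLength_pos k
  calc -(x * |Real.log (cycleWeight d β k) / k|)
      ≤ -(r * |Real.log (cycleWeight d β k) / k|) := by gcongr
    _ ≤ r * (Real.log (cycleWeight d β k) / k) := by
        rw [neg_mul_eq_mul_neg]
        exact mul_le_mul_of_nonneg_left (neg_abs_le _) hr
    _ = r / k * Real.log (cycleWeight d β k) := by ring
    _ ≤ _ := mul_log_le_cycleEntropy (by positivity) ((div_le_one hk).2 (hrx.trans hxk))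

lemma tendsto_Iio_pnat_atTop : Tendsto (fun k : ℕ+ => Finset.Iio k) atTop atTop :=
  tendsto_atTop_finset_of_monotone (fun _ _ h => Finset.Iio_subset_Iio h)
    fun k => ⟨k + 1, Finset.mem_Iio.2 (PNat.lt_add_right k 1)⟩

end LongCycle

namespace IsConjugate

variable {d : ℕ} {β x s : ℝ}

lemma sum_mul_le (hβ : 0 < β) (h : IsConjugate d β x s) (J : Finset ℕ+) :
    ∑ k ∈ J, (k : ℝ) * (cycleWeight d β k * Real.exp (β * s * k)) ≤ x := by
  rcases h.nonpos.lt_or_eq with hs | rfl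
  · rw [← h.density_eq hs]
    simp only [← mul_assoc]
    exact (summable_idealDensity hβ hs).sum_le_tsum J fun k _ => (idealDensity_term_pos hβ s k).le
  · simpa only [mul_zero, zero_mul, Real.exp_zero, mul_one] using
      sum_mul_cycleWeight_le hβ (h.density_le rfl) J

/-- At `s = 0` the sums may stay below `x`, but then the prefactor vanishes. -/
lemma tendsto_mul_sum (hβ : 0 < β) (h : IsConjugate d β x s) :
    Tendsto (fun K : ℕ+ => β * s * ∑ k ∈ Finset.Iio K,
      (k : ℝ) * (cycleWeight d β k * Real.exp (β * s * k))) atTop (𝓝 (β * s * x)) := by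
  rcases h.nonpos.lt_or_eq with hs | rfl
  · rw [← h.density_eq hs]
    simp only [← mul_assoc]
    exact ((summable_idealDensity hβ hs).hasSum.comp tendsto_Iio_pnat_atTop).const_mul _
  · simp only [mul_zero, zero_mul, tendsto_const_nhds]

/-- Short cycles at the potential `s` have the right entropy but may miss part of the density `x`.
The missing part is put into cycles of one large length `K`, whose entropy cost is negligible
because `log q_K / K → 0`. -/
lemma exists_lt_sum_cycleEntropy (hd : 1 ≤ d) (hβ : 0 < β) (h : IsConjugate d β x s) {c : ℝ}
    (hc : c < β * (idealPressure d β s - s * x)) :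
    ∃ (J : Finset ℕ+) (t : ℕ+ → ℝ), (∀ k ∈ J, 0 ≤ t k) ∧ ∑ k ∈ J, k * t k = x ∧
      c < ∑ k ∈ J, cycleEntropy (cycleWeight d β k) (t k) := by
  set w : ℕ+ → ℝ := fun k => cycleWeight d β k * Real.exp (β * s * k)
  have hw : ∀ k, 0 < w k := fun k => mul_pos (cycleWeight_pos hβ k) (Real.exp_pos _)
  have hsum : HasSum w (β * idealPressure d β s) := by
    rw [idealPressure, ← mul_assoc, mul_one_div_cancel hβ.ne', one_mul]
    exact (summable_cycleWeight_mul_exp hd hβ h.nonpos).hasSum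
  have hlim := ((hsum.comp tendsto_Iio_pnat_atTop).sub (h.tendsto_mul_sum hβ)).sub
    ((tendsto_log_cycleWeight_div (d := d) hβ).abs.const_mul x)
  rw [abs_zero, mul_zero, sub_zero, mul_assoc, ← mul_sub] at hlim
  obtain ⟨K, hK, hxK⟩ := ((hlim.eventually_const_lt hc).and
    (tendsto_cycleLength_atTop.eventually_ge_atTop x)).exists
  set r := x - ∑ k ∈ Finset.Iio K, (k : ℝ) * w k with hr
  have hr0 : 0 ≤ r := sub_nonneg.2 (h.sum_mul_le hβ _)
  have hrx : r ≤ x := sub_le_self _ (Finset.sum_nonneg fun k _ => by have := (hw k).le; positivity)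
  set t := Function.update w K (r / K)
  have htK : t K = r / K := Function.update_self ..
  have htw : ∀ k ∈ Finset.Iio K, t k = w k := fun k hk =>
    Function.update_of_ne (Finset.mem_Iio.1 hk).ne _ _
  have hKJ : K ∉ Finset.Iio K := fun hK => (Finset.mem_Iio.1 hK).false
  refine ⟨insert K (Finset.Iio K), t, (Finset.forall_mem_insert _ _ _).2 ⟨?_, fun k hk => ?_⟩,
    ?_, ?_⟩
  · exact htK.symm ▸ div_nonneg hr0 (cycleLength_pos K).le
  · exact htw k hk ▸ (hw k).le
  · rw [Finset.sum_insert hKJ, htK, mul_div_cancel₀ _ (cycleLength_pos K).ne',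
      Finset.sum_congr rfl fun k hk => by rw [htw k hk], hr, sub_add_cancel]
  · have hshort : ∑ k ∈ Finset.Iio K, cycleEntropy (cycleWeight d β k) (t k) =
        ∑ k ∈ Finset.Iio K, w k - β * s * ∑ k ∈ Finset.Iio K, (k : ℝ) * w k := by
      rw [Finset.mul_sum, ← Finset.sum_sub_distrib]
      refine Finset.sum_congr rfl fun k hk => ?_
      rw [htw k hk, cycleEntropy_mul_exp (cycleWeight_pos hβ k), mul_assoc (β * s)]
    have hlong := neg_mul_abs_le_cycleEntropy_div (d := d) (β := β) hr0 hrx hxK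
    rw [Finset.sum_insert hKJ, htK, hshort]
    exact hK.trans_le (by simp only [Function.comp_apply]; linarith)

end IsConjugate

/-- The cycle counts with `⌊t_k V⌋` cycles of each length `k ∈ J`. -/
noncomputable def shortCounts (J : Finset ℕ+) (t : ℕ+ → ℝ) (V : ℝ) : CycleCounts :=
  Finsupp.indicator J fun k _ => ⌊t k * V⌋₊

section ShortCounts

variable {d j m : ℕ} {β V : ℝ} {J : Finset ℕ+} {l : ℕ+}

lemma disjoint_support_shortCounts_single (t : ℕ+ → ℝ) (V : ℝ) (hl : l ∉ J) (j : ℕ) :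
    Disjoint (shortCounts J t V).support (Finsupp.single l j).support :=
  (Finset.disjoint_singleton_right.2 hl).mono (Finsupp.support_indicator_subset _ _)
    Finsupp.support_single_subset

lemma particleDensity_shortCounts_add_single (t : ℕ+ → ℝ) (V : ℝ) (hl : l ∉ J) (j : ℕ) :
    particleDensity V (shortCounts J t V + Finsupp.single l j) =
      ∑ k ∈ J, (k : ℝ) * ((⌊t k * V⌋₊ : ℝ) / V) + l * ((j : ℝ) / V) := by
  rw [particleDensity,
    Finsupp.sum_add_index_of_disjoint (disjoint_support_shortCounts_single t V hl j),
    Finsupp.sum_single_index (by simp), shortCounts, Finsupp.sum_indicator_index _ (by simp)]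

lemma log_refWeight_shortCounts_add_single (hβ : 0 < β) (t : ℕ+ → ℝ) (hV : 0 < V) (hl : l ∉ J)
    (hj : j ≤ 1) : Real.log (refWeight d β V (shortCounts J t V + Finsupp.single l j)) =
      ∑ k ∈ J, Real.log ((V * cycleWeight d β k) ^ ⌊t k * V⌋₊ / (⌊t k * V⌋₊.factorial : ℝ)) +
        j * Real.log (V * cycleWeight d β l) := by
  have hq : ∀ k, V * cycleWeight d β k ≠ 0 := fun k => (mul_pos hV (cycleWeight_pos hβ k)).ne'
  have hterm : ∀ k ∈ J, (V * cycleWeight d β k) ^ ⌊t k * V⌋₊ / (⌊t k * V⌋₊.factorial : ℝ) ≠ 0 :=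
    fun k _ => div_ne_zero (pow_ne_zero _ (hq k)) (by positivity)
  rw [refWeight,
    Finsupp.prod_add_index_of_disjoint (disjoint_support_shortCounts_single t V hl j),
    Finsupp.prod_single_index (by simp), shortCounts, Finsupp.prod_indicator_index _ (by simp),
    Nat.factorial_eq_one.2 hj, Nat.cast_one, div_one,
    Real.log_mul (Finset.prod_ne_zero_iff.2 hterm) (pow_ne_zero _ (hq l)), Real.log_prod hterm,
    Real.log_pow]

lemma sq_le_counterTerm_shortCounts_add_single (t : ℕ+ → ℝ) (V : ℝ) (hl : l ∉ J) (j : ℕ)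
    (hm : m ≤ l) : (l * ((j : ℝ) / V)) ^ 2 ≤
      counterTerm V m (shortCounts J t V + Finsupp.single l j) := by
  rw [counterTerm,
    Finsupp.sum_add_index_of_disjoint (disjoint_support_shortCounts_single t V hl j),
    Finsupp.sum_single_index (by simp), if_pos hm, mul_pow]
  refine le_add_of_nonneg_left (Finset.sum_nonneg fun k _ => ?_)
  dsimp only
  split_ifs <;> positivity

end ShortCounts

lemma le_finitePressure {d m : ℕ} {β a b V : ℝ} (hd : 1 ≤ d) (hβ : 0 < β) (hb : 0 ≤ b)
    (hab : b < a) (hV : 0 < V) (α μ : ℝ) (N : CycleCounts) :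
    μ * particleDensity V N - a / 2 * particleDensity V N ^ 2 + b / 2 * counterTerm V m N +
      Real.log (refWeight d β V N) / V / β ≤ finitePressure d β α μ a b V m := by
  have hlog := Real.log_le_log (boltzmannWeight_pos hβ hV μ a b m N)
    (boltzmannWeight_le_partitionFunction hd hβ hb hab hV α μ m N)
  rw [boltzmannWeight, Real.log_mul (refWeight_pos hβ hV N).ne' (Real.exp_pos _).ne',
    Real.log_exp] at hlog
  refine le_trans (le_of_eq ?_) (mul_le_mul_of_nonneg_left hlog
    (show 0 ≤ 1 / (β * V) by positivity))
  field_simp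
  ring

section SingleLongCycle

variable {d j : ℕ} {β a b p x y : ℝ} {V : ℕ → ℝ} {m : ℕ → ℕ} {l : ℕ → ℕ+} {J : Finset ℕ+}
  {t : ℕ+ → ℝ}

lemma eventually_notMem_of_tendsto_atTop (hl : Tendsto l atTop atTop) (J : Finset ℕ+) :
    ∀ᶠ n in atTop, l n ∉ J := by
  filter_upwards [(eventually_all_finset J).2 fun k _ => hl.eventually_gt_atTop k] with n hn hmem
  exact lt_irrefl _ (hn _ hmem)

lemma tendsto_particleDensity_shortCounts_add_single (hV : Tendsto V atTop atTop)
    (hl : Tendsto l atTop atTop) (hly : Tendsto (fun n => (l n : ℝ) * ((j : ℝ) / V n)) atTop (𝓝 y))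
    (ht : ∀ k ∈ J, 0 ≤ t k) :
    Tendsto (fun n => particleDensity (V n) (shortCounts J t (V n) + Finsupp.single (l n) j)) atTop
      (𝓝 (∑ k ∈ J, k * t k + y)) := by
  have hlim := (tendsto_finsetSum J fun k hk =>
    ((tendsto_nat_floor_mul_div_atTop (ht k hk)).comp hV).const_mul (k : ℝ)).add hly
  refine hlim.congr' ?_
  filter_upwards [eventually_notMem_of_tendsto_atTop hl J] with n hn
  exact (particleDensity_shortCounts_add_single t (V n) hn j).symm

lemma tendsto_log_refWeight_shortCounts_add_single (hβ : 0 < β) (hV : Tendsto V atTop atTop)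
    (hl : Tendsto l atTop atTop) (hj : j ≤ 1)
    (hly : Tendsto (fun n => (l n : ℝ) * ((j : ℝ) / V n)) atTop (𝓝 y)) (ht : ∀ k ∈ J, 0 ≤ t k) :
    Tendsto (fun n =>
      Real.log (refWeight d β (V n) (shortCounts J t (V n) + Finsupp.single (l n) j)) / V n) atTop
      (𝓝 (∑ k ∈ J, cycleEntropy (cycleWeight d β k) (t k))) := by
  have hshort := tendsto_finsetSum J fun k hk =>
    (tendsto_log_pow_div_factorial (cycleWeight_pos (d := d) hβ k) (ht k hk)).comp hV
  have hlong := ((tendsto_log_div_atTop.comp hV).const_mul (j : ℝ)).add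
    (((tendsto_log_cycleWeight_div (d := d) hβ).comp hl).mul hly)
  have hlim := hshort.add hlong
  rw [mul_zero, zero_mul, add_zero, add_zero] at hlim
  refine hlim.congr' ?_
  filter_upwards [eventually_notMem_of_tendsto_atTop hl J, hV.eventually_gt_atTop 0] with n hn hVn
  have hln := (cycleLength_pos (l n)).ne'
  rw [log_refWeight_shortCounts_add_single hβ t hVn hn hj, add_div, Finset.sum_div,
    Real.log_mul hVn.ne' (cycleWeight_pos hβ _).ne']
  simp only [Function.comp_apply]
  field_simp

lemma eventually_lt_finitePressure_of_cycleEntropy (hd : 1 ≤ d) (hβ : 0 < β) (hb : 0 ≤ b)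
    (hab : b < a) (α : ℝ) {μ : ℝ} (hV : Tendsto V atTop atTop) (hml : ∀ n, m n ≤ l n)
    (hl : Tendsto l atTop atTop) (hj : j ≤ 1)
    (hly : Tendsto (fun n => (l n : ℝ) * ((j : ℝ) / V n)) atTop (𝓝 y)) (ht : ∀ k ∈ J, 0 ≤ t k)
    (hx : ∑ k ∈ J, k * t k = x)
    (hp : p < μ * (x + y) - a / 2 * (x + y) ^ 2 + b / 2 * y ^ 2 +
      (∑ k ∈ J, cycleEntropy (cycleWeight d β k) (t k)) / β) :
    ∀ᶠ n in atTop, p < finitePressure d β α μ a b (V n) (m n) := by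
  have hdensity := tendsto_particleDensity_shortCounts_add_single hV hl hly ht
  have hentropy := tendsto_log_refWeight_shortCounts_add_single (d := d) hβ hV hl hj hly ht
  rw [hx] at hdensity
  have hlim := (((hdensity.const_mul μ).sub ((hdensity.pow 2).const_mul (a / 2))).add
    ((hly.pow 2).const_mul (b / 2))).add (hentropy.div_const β)
  filter_upwards [hlim.eventually_const_lt hp, eventually_notMem_of_tendsto_atTop hl J,
    hV.eventually_gt_atTop 0] with n hpn hn hVn
  have hcounter := mul_le_mul_of_nonneg_left
    (sq_le_counterTerm_shortCounts_add_single t (V n) hn j (hml n)) (div_nonneg hb zero_le_two)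
  have hle := le_finitePressure (m := m n) hd hβ hb hab hVn α μ
    (shortCounts J t (V n) + Finsupp.single (l n) j)
  linarith

end SingleLongCycle

/-! ### The thermodynamic limit -/

section Limit

variable {d : ℕ} {β a b μ p y : ℝ} {κ : ℝ≥0∞} {V : ℕ → ℝ} {m : ℕ → ℕ}

lemma eventually_forall_longDensities_lt {f : ℝ → ℝ} (hf : Continuous f)
    (hbot : Tendsto f atTop atBot) {S : ℝ} (h : ∀ y ∈ longDensities κ, f y < S) :
    ∀ᶠ κ' in 𝓝 κ, ∀ y ∈ longDensities κ', f y < S := by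
  set bad : Set ℝ := {y | 0 ≤ y ∧ S ≤ f y}
  have hclosed : IsClosed bad := isClosed_Ici.inter (isClosed_le continuous_const hf)
  obtain ⟨R, hR⟩ := eventually_atTop.1 (hbot.eventually_lt_atBot S)
  have hbad : bad ⊆ Icc 0 R := fun y hy => ⟨hy.1, not_lt.1 fun hRy => (hR y hRy.le).not_ge hy.2⟩
  rcases bad.eq_empty_or_nonempty with hempty | hne
  · exact .of_forall fun κ' y hy => not_le.1 fun hS =>
      (eq_empty_iff_forall_notMem.1 hempty y) ⟨hy.1, hS⟩
  obtain ⟨z, hz, hzmax⟩ := (isCompact_Icc.of_isClosed_subset hclosed hbad).exists_isGreatest hne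
  have hzκ : ENNReal.ofReal z < κ := not_le.1 fun hκ => (h z ⟨hz.1, .inr hκ⟩).not_ge hz.2
  filter_upwards [lt_mem_nhds hzκ] with κ' hκ' y hy
  refine hy.2.elim (fun hy0 => hy0 ▸ h 0 (zero_mem_longDensities κ)) fun hκy =>
    not_le.1 fun hS => ?_
  exact (hκ'.trans_le hκy).not_ge (ENNReal.ofReal_le_ofReal (hzmax ⟨hy.1, hS⟩))

/-- A density `y > 0` is carried by a single cycle of length about `max (m n) (y V n)`. -/
lemma exists_longCycle (hV : Tendsto V atTop atTop) (hm : Tendsto m atTop atTop)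
    (hκ : Tendsto (fun n => ENNReal.ofReal (m n / V n)) atTop (𝓝 κ)) (hy : y ∈ longDensities κ) :
    ∃ (l : ℕ → ℕ+) (j : ℕ), j ≤ 1 ∧ (∀ n, m n ≤ l n) ∧ Tendsto l atTop atTop ∧
      Tendsto (fun n => (l n : ℝ) * ((j : ℝ) / V n)) atTop (𝓝 y) := by
  set l : ℕ → ℕ+ := fun n => (max (m n) ⌈y * V n⌉₊).succPNat with hl
  have hml : ∀ n, m n ≤ l n := fun n => (le_max_left _ _).trans (Nat.le_succ _)
  have hl_atTop : Tendsto l atTop atTop := tendsto_atTop.2 fun k => by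
    filter_upwards [hm.eventually_ge_atTop k] with n hn
    exact PNat.coe_le_coe _ _ |>.1 (hn.trans (hml n))
  obtain ⟨hy0, rfl | hκy⟩ := hy
  · exact ⟨l, 0, zero_le_one, hml, hl_atTop, by simp only [Nat.cast_zero, zero_div, mul_zero,
      tendsto_const_nhds]⟩
  have hκtop : κ ≠ ⊤ := ne_top_of_le_ne_top ENNReal.ofReal_ne_top hκy
  have hm_div : Tendsto (fun n => (m n : ℝ) / V n) atTop (𝓝 κ.toReal) := by
    refine ((ENNReal.tendsto_toReal hκtop).comp hκ).congr' ?_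
    filter_upwards [hV.eventually_gt_atTop 0] with n hn
    exact ENNReal.toReal_ofReal (by positivity)
  have hceil_div : Tendsto (fun n => (⌈y * V n⌉₊ : ℝ) / V n) atTop (𝓝 y) :=
    (tendsto_nat_ceil_mul_div_atTop hy0).comp hV
  have hlim := (hm_div.max hceil_div).add (hV.const_div_atTop 1)
  rw [max_eq_right (ENNReal.toReal_le_of_le_ofReal hy0 hκy), add_zero] at hlim
  refine ⟨l, 1, le_rfl, hml, hl_atTop, hlim.congr' ?_⟩
  filter_upwards [hV.eventually_gt_atTop 0] with n hn
  rw [max_div_div_right hn.le, hl]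
  push_cast [Nat.succPNat_coe, Nat.succ_eq_add_one]
  ring

lemma eventually_lt_finitePressure (hd : 1 ≤ d) (hβ : 0 < β) (hb : 0 ≤ b) (hab : b < a) (α : ℝ)
    (hV : Tendsto V atTop atTop) (hm : Tendsto m atTop atTop)
    (hκ : Tendsto (fun n => ENNReal.ofReal (m n / V n)) atTop (𝓝 κ)) (hy : y ∈ longDensities κ)
    (hp : p < reducedFunctional d β a b μ y) :
    ∀ᶠ n in atTop, p < finitePressure d β α μ a b (V n) (m n) := by
  have ha := hb.trans_lt hab
  set x := optimalDensity d β a (μ - a * y)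
  set σ := effectivePotential d β a (μ - a * y)
  have hconj : IsConjugate d β x σ := isConjugate_effectivePotential hβ ha _
  set energy := μ * (x + y) - a / 2 * (x + y) ^ 2 + b / 2 * y ^ 2 with henergy
  have hfunctional : reducedFunctional d β a b μ y = energy + (idealPressure d β σ - σ * x) := by
    rw [← pressureFunctional_optimalDensity hd hβ ha, pressureFunctional, hconj.freeEnergy_eq hd hβ]
    ring
  have hentropy : β * (p - energy) < β * (idealPressure d β σ - σ * x) :=
    mul_lt_mul_of_pos_left (by linarith) hβ
  obtain ⟨J, t, ht, hx, hlt⟩ := hconj.exists_lt_sum_cycleEntropy hd hβ hentropy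
  obtain ⟨l, j, hj, hml, hl, hly⟩ := exists_longCycle hV hm hκ hy
  refine eventually_lt_finitePressure_of_cycleEntropy hd hβ hb hab α hV hml hl hj hly ht hx ?_
  rw [← henergy, ← sub_lt_iff_lt_add', lt_div_iff₀' hβ]
  exact hlt

/-- The upper bound in finite volume is at a slightly larger chemical potential `ν`, and the maximal
pressure is continuous in the chemical potential. -/
lemma eventually_finitePressure_lt (hd : 1 ≤ d) (hβ : 0 < β) (hb : 0 ≤ b) (hab : b < a) (α : ℝ)
    (hV : Tendsto V atTop atTop) (hm : Tendsto m atTop atTop)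
    (hκ : Tendsto (fun n => ENNReal.ofReal (m n / V n)) atTop (𝓝 κ))
    (hp : maxPressure d β a b (longDensities κ) μ < p) :
    ∀ᶠ n in atTop, finitePressure d β α μ a b (V n) (m n) < p := by
  have ha := hb.trans_lt hab
  have hcont := continuous_maxPressure (d := d) hd hβ ha hab (isClosed_longDensities κ)
    ⟨0, zero_mem_longDensities κ⟩ (longDensities_subset_Ici κ)
  obtain ⟨ν, hν, hμν⟩ := ((hcont.continuousAt.eventually_lt_const hp).filter_mono
    nhdsWithin_le_nhds |>.and (self_mem_nhdsWithin (s := Ioi μ))).exists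
  obtain ⟨S, hνS, hSp⟩ := exists_between hν
  obtain ⟨z, hz, hmax⟩ := exists_isMaxOn_longDensities (d := d) hd hβ ha hab κ ν
  rw [maxPressure_eq hz hmax] at hνS
  have hS := hκ.eventually (eventually_forall_longDensities_lt
    (continuous_reducedFunctional hd hβ ha b ν)
    (tendsto_reducedFunctional_atTop hd hβ ha hab ν) fun y hy =>
      lt_of_le_of_lt (hmax hy) hνS)
  have herror := ((((tendsto_tailWeight hd hβ).comp hm).div_const β).const_add S).add
    ((hV.const_mul_atTop hβ).const_div_atTop (Real.log (1 - Real.exp (-(β * (ν - μ))))⁻¹))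
  rw [zero_div, add_zero, add_zero] at herror
  filter_upwards [hV.eventually_gt_atTop 0, hS, herror.eventually_lt_const hSp] with n hn hSn hlt
  refine lt_of_le_of_lt ?_ hlt
  exact finitePressure_le hd hβ hb hab hn α (sub_pos.2 hμν) fun y hy => by
    rw [add_sub_cancel]
    exact (hSn y hy).le

lemma tendsto_finitePressure (hd : 1 ≤ d) (hβ : 0 < β) (hb : 0 ≤ b) (hab : b < a) (α μ : ℝ)
    (hV : Tendsto V atTop atTop) (hm : Tendsto m atTop atTop)
    (hκ : Tendsto (fun n => ENNReal.ofReal (m n / V n)) atTop (𝓝 κ)) :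
    Tendsto (fun n => finitePressure d β α μ a b (V n) (m n)) atTop
      (𝓝 (maxPressure d β a b (longDensities κ) μ)) := by
  refine tendsto_order.2 ⟨fun p hp => ?_, fun p =>
    eventually_finitePressure_lt hd hβ hb hab α hV hm hκ⟩
  obtain ⟨y, hy, hmax⟩ := exists_isMaxOn_longDensities (d := d) hd hβ (hb.trans_lt hab) hab κ μ
  rw [maxPressure_eq hy hmax] at hp
  exact eventually_lt_finitePressure hd hβ hb hab α hV hm hκ hy hp

lemma volume_centredBox_lt_top (L : Fin d → ℝ) : volume (centredBox L) < ⊤ := by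
  refine Bornology.IsBounded.measure_lt_top ?_
  refine (Metric.isBounded_closedBall (x := (0 : EuclideanSpace ℝ (Fin d)))
    (r := √(∑ i, (L i / 2) ^ 2))).subset fun x hx => ?_
  rw [mem_closedBall_zero_iff, EuclideanSpace.norm_eq]
  gcongr with i
  exact hx i

theorem hasPressure_maxPressure (hd : 1 ≤ d) (hβ : 0 < β) (hb : 0 ≤ b) (hab : b < a) (α μ : ℝ)
    (κ : ℝ≥0∞) : HasPressure d β α μ a b κ (maxPressure d β a b (longDensities κ) μ) := by
  intro L m _ hvol hm hκ
  have hfin := fun n => (volume_centredBox_lt_top (L n)).ne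
  have hV : Tendsto (fun n => (volume (centredBox (L n))).toReal) atTop atTop := by
    refine tendsto_atTop.2 fun R => ?_
    filter_upwards [hvol.eventually_const_lt (ENNReal.ofReal_lt_top (r := R))] with n hn
    exact (ENNReal.ofReal_le_iff_le_toReal (hfin n)).1 hn.le
  refine tendsto_finitePressure hd hβ hb hab α μ hV hm (hκ.congr' ?_)
  filter_upwards [hV.eventually_gt_atTop 0] with n hn
  rw [ENNReal.ofReal_div_of_pos hn, ENNReal.ofReal_toReal (hfin n), ENNReal.ofReal_natCast]

theorem hasPressure_of_isMaxOn (hd : 1 ≤ d) (hβ : 0 < β) (hb : 0 ≤ b) (hab : b < a) (α : ℝ)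
    (hy : y ∈ longDensities κ)
    (hmax : IsMaxOn (reducedFunctional d β a b μ) (longDensities κ) y) :
    HasPressure d β α μ a b κ (reducedFunctional d β a b μ y) :=
  maxPressure_eq hy hmax ▸ hasPressure_maxPressure hd hβ hb hab α μ κ

lemma hasPressure_pSub (hd : 1 ≤ d) (hβ : 0 < β) (hb : 0 ≤ b) (hab : b < a) (α : ℝ)
    (hmax : IsMaxOn (reducedFunctional d β a b μ) (longDensities κ) 0) :
    HasPressure d β α μ a b κ (pSub d β a μ) :=
  reducedFunctional_zero (b := b) ▸
    hasPressure_of_isMaxOn hd hβ hb hab α (zero_mem_longDensities κ) hmax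

lemma hasPressure_top (hd : 1 ≤ d) (hβ : 0 < β) (hb : 0 ≤ b) (hab : b < a) (α μ : ℝ) :
    HasPressure d β α μ a b ⊤ (pSub d β a μ) := by
  refine hasPressure_pSub hd hβ hb hab α (isMaxOn_iff.2 fun y hy => ?_)
  rw [longDensities_top] at hy
  rw [mem_singleton_iff.1 hy]

lemma IsPeak.hasPressure_pSup (hd : 1 ≤ d) (hβ : 0 < β) (hb : 0 < b) (hab : b < a) (α : ℝ)
    (h : IsPeak d β a b μ y) (hy : y ∈ longDensities κ) :
    HasPressure d β α μ a b κ (pSup d β a b μ) :=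
  h.pSup_eq hd hβ hb hab ▸ hasPressure_of_isMaxOn hd hβ hb.le hab α hy
    (h.isMaxOn.on_subset (longDensities_subset_Ici κ))

namespace IsThreshold

variable {m : ℝ}

lemma hasPressure_pSub (hd : 1 ≤ d) (hβ : 0 < β) (hb : 0 ≤ b) (hab : b < a)
    (h : IsThreshold d β a b m) (κ : ℝ≥0∞) (α : ℝ) (hμ : μ ≤ m) :
    HasPressure d β α μ a b κ (pSub d β a μ) :=
  CycleHYL.hasPressure_pSub hd hβ hb hab α
    ((h.isMaxOn_zero μ hμ).on_subset (longDensities_subset_Ici κ))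

lemma hasPressure_pSup (hd : 1 ≤ d) (hβ : 0 < β) (hb : 0 < b) (hab : b < a)
    (h : IsThreshold d β a b m) (α : ℝ) (hμ : m ≤ μ)
    (hmem : ∀ y, IsPeak d β a b μ y → y ∈ longDensities κ) :
    HasPressure d β α μ a b κ (pSup d β a b μ) := by
  rcases hμ.eq_or_lt with rfl | hlt
  · rw [h.pSup_eq hd hβ hb hab, reducedFunctional_zero]
    exact h.hasPressure_pSub hd hβ hb.le hab κ α le_rfl
  · obtain ⟨y, hy⟩ := h.exists_isPeak μ hlt
    exact hy.hasPressure_pSup hd hβ hb hab α (hmem y hy)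

end IsThreshold

end Limit

end CycleHYL

open CycleHYL

theorem mainTheorem4 (d : ℕ) (hd : 1 ≤ d) (β a b : ℝ) (hβ : 0 < β) (hb : 0 < b) (hab : b < a) :
    ∃ μstar : ℝ,
      (CycleHYL.IsTransition d β a b 0 μstar ∧
        CycleHYL.muT d β a b ≤ μstar ∧ (μstar : EReal) ≤ CycleHYL.muC d β a) ∧
      (∀ α < 0, ∀ μ : ℝ,
        (μ ≤ μstar → CycleHYL.HasPressure d β α μ a b 0 (CycleHYL.pSub d β a μ)) ∧
        (μstar ≤ μ → CycleHYL.HasPressure d β α μ a b 0 (CycleHYL.pSup d β a b μ))) ∧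
      (∀ κ : ℝ, 0 < κ →
        ∃ μstarκ : ℝ,
          (CycleHYL.IsTransition d β a b (ENNReal.ofReal κ) μstarκ ∧
            (CycleHYL.muR d β a b κ ≤ μstar → μstarκ = μstar) ∧
            (μstar < CycleHYL.muR d β a b κ →
              μstar < μstarκ ∧ μstarκ < CycleHYL.muR d β a b κ)) ∧
          (∀ α < 0, ∀ μ : ℝ,
            (μ ≤ μstarκ →
              CycleHYL.HasPressure d β α μ a b (ENNReal.ofReal κ) (CycleHYL.pSub d β a μ)) ∧
            (μstarκ ≤ μ → μ ≤ CycleHYL.muR d β a b κ →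
              CycleHYL.HasPressure d β α μ a b (ENNReal.ofReal κ)
                (CycleHYL.pSub d β a (μ - a * κ) + μ * κ - (a - b) / 2 * κ ^ 2)) ∧
            (max (CycleHYL.muR d β a b κ) μstar ≤ μ →
              CycleHYL.HasPressure d β α μ a b (ENNReal.ofReal κ)
                (CycleHYL.pSup d β a b μ)))) ∧
      (∀ α < 0, ∀ μ : ℝ,
        CycleHYL.HasPressure d β α μ a b ⊤ (CycleHYL.pSub d β a μ)) := by
  have ha := hb.trans hab
  obtain ⟨μstar, h⟩ := exists_isThreshold (d := d) hd hβ hb hab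
  refine ⟨μstar, ⟨h.isTransition_of_forall_isPeak_mem hd hβ ha hb fun _ _ _ hy =>
    hy.mem_longDensities_zero, h.muT_le hd hβ hb hab, h.le_muC hd hβ ha hb⟩,
    fun α _ μ => ⟨h.hasPressure_pSub hd hβ hb.le hab 0 α, fun hμ =>
      h.hasPressure_pSup hd hβ hb hab α hμ fun _ hy => hy.mem_longDensities_zero⟩,
    fun κ hκ => ?_, fun α _ μ => hasPressure_top hd hβ hb.le hab α μ⟩
  obtain ⟨μstarκ, htransition, heq, hIoo, hzero, hself⟩ := h.exists_isTransition hd hβ hb hab hκ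
  refine ⟨μstarκ, ⟨htransition, heq, hIoo⟩, fun α _ μ => ⟨fun hμ => ?_, fun hle hge => ?_,
    fun hμ => ?_⟩⟩
  · exact hasPressure_pSub hd hβ hb.le hab α (hzero μ hμ)
  · exact hasPressure_of_isMaxOn hd hβ hb.le hab α (self_mem_longDensities hκ) (hself μ ⟨hle, hge⟩)
  · exact h.hasPressure_pSup hd hβ hb hab α ((le_max_right _ _).trans hμ) fun _ hy =>
      hy.mem_longDensities hd hβ hb hab hκ ((le_max_left _ _).trans hμ)
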